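/- **Setting.** An almost para-hypercomplex structure on a smooth manifold $M$ is a triple $(J_1,J_2,J_3)$ of smooth endomorphism fields of $TM$ with $J_1^2=-J_2^2=-J_3^2=-\mathrm{Id}$ and $J_1J_2=-J_2J_1=J_3$; it is a para-hypercomplex structure if the Nijenhuis tensors of $J_1,J_2,J_3$ vanish. A pseudo-Riemannian metric $g$ on $M$ is compatible with it if $g(J_1X,J_1Y)=-g(J_2X,J_2Y)=-g(J_3X,J_3Y)=g(X,Y)$; then $(g,J_1,J_2,J_3)$ is called para-hyperhermitian, with fundamental forms $\Omega_i(X,Y)=g(J_iX,Y)$. Let $\varepsilon\in\{1,-1\}$. Let $N=(n_{ij})\in GL(2,\mathbb Z)$ with $\det N=\varepsilon$ have real eigenvalues $\alpha>1$ and $\varepsilon/\alpha$, with corresponding real eigenvectors $(a_1,a_2)$ and $(b_1,b_2)$. Let $p,q,r$ be integers, $r\neq0$, put $A=(b_1a_2-b_2a_1)/r$, and let $c=(c_1,c_2)^T\in\mathbb R^2$ be the solution of $\varepsilon c=Nc+(e_1,e_2)^T+A\,(p,q)^T$, where $e_i=\tfrac12n_{i1}(n_{i1}-1)a_1b_1+\tfrac12n_{i2}(n_{i2}-1)a_2b_2+n_{i1}n_{i2}b_1a_2$.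 Let $\mathbb H$ be the upper half-plane. The group generated by $$\phi_0(z,w)=(\alpha z,\varepsilon w),\quad \phi_i(z,w)=(z+a_i,\,w+b_iz+c_i)\ (i=1,2),\quad \phi_3(z,w)=(z,w+A)$$ acts freely and properly discontinuously on $\mathbb H\times\mathbb C$. The quotient complex surface is, for $\varepsilon=-1$, an Inoue surface of type $S^-$ and, for $\varepsilon=1$, an Inoue surface of type $S^+$ with parameter $t=0$. **Theorem.** Let $S^-$ be any Inoue surface of type $S^-$, given by $N,p,q,r,\alpha,a,b,c$. Then: (1) For suitable integers $p',q'$ the data $N^2,p',q',r,\alpha^2,a,b,c$ define an Inoue surface $S^+$ of type $S^+$ with $t=0$. The identity of $\mathbb H\times\mathbb C$ induces a holomorphic covering map $\kappa:S^+\to S^-$ that is locally biholomorphic, the map $(z,w)\mapsto(\alpha z,-w)$ induces a fixed point free holomorphic involution $\sigma$ of $S^+$, and the fibres of $\kappa$ are exactly the orbits $\{m,\sigma(m)\}$; that is, $S^-=S^+/\sigma$. (2) On $\mathbb H\times\mathbb C$ put $\theta_1=\frac{dz}{\operatorname{Im}z}$, $\theta_2=dw-\frac{\operatorname{Im}w}{\operatorname{Im}z}\,dz$,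 $\Omega=\theta_1\wedge\theta_2$ and $\Omega_1=\operatorname{Re}(\theta_1\wedge\overline{\theta_2})$. There is a para-hyperhermitian structure $(g,J_1,J_2,J_3)$ on $S^+$ whose $J_1$ is the complex structure of $S^+$ and whose fundamental forms pull back to $(\Omega_1,\operatorname{Re}\Omega,\operatorname{Im}\Omega)$ on $\mathbb H\times\mathbb C$. The involution $\sigma$ is an anti-isometry: $\sigma^*g=-g$. (3) The para-hypercomplex structure $(J_1,J_2,J_3)$ descends through $\kappa$ to a para-hypercomplex structure on $S^-$ whose first member is the complex structure of $S^-$, and this structure on $S^-$ admits no compatible metric. In particular, every Inoue surface of type $S^-$ carries a para-hypercomplex structure that admits no compatible metric. -/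

import Mathlib

open scoped Manifold ContDiff Topology

/-! ### Para-hypercomplex structures and compatible metrics on smooth manifolds -/

section ParaHypercomplex

variable {E : Type*} [NormedAddCommGroup E] [NormedSpace ℝ E]
  (M : Type*) [TopologicalSpace M] [ChartedSpace E M] [IsManifold 𝓘(ℝ, E) ∞ M]

/-- A field of endomorphisms of the tangent spaces (not yet assumed to be smooth). -/
abbrev EndoField : Type _ :=
  ∀ x : M, TangentSpace 𝓘(ℝ, E) x →L[ℝ] TangentSpace 𝓘(ℝ, E) x

variable {M}

/-- A field of endomorphisms is smooth: it is a smooth section of the bundle `End(TM)`. -/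
def EndoField.IsSmooth (J : EndoField (E := E) M) : Prop :=
  ContMDiff 𝓘(ℝ, E) (𝓘(ℝ, E).prod 𝓘(ℝ, E →L[ℝ] E)) ∞
    (fun x ↦ Bundle.TotalSpace.mk' (E →L[ℝ] E)
      (E := fun x : M ↦ TangentSpace 𝓘(ℝ, E) x →L[ℝ] TangentSpace 𝓘(ℝ, E) x) x (J x))

/-- The Nijenhuis tensor
`[JV, JW] - J[JV, W] - J[V, JW] + J²[V, W]`
evaluated on two vector fields at a point. -/
noncomputable def EndoField.nijenhuis (J : EndoField (E := E) M)
    (V W : ∀ x : M, TangentSpace 𝓘(ℝ, E) x) (x : M) : TangentSpace 𝓘(ℝ, E) x :=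
  VectorField.mlieBracket 𝓘(ℝ, E) (fun y ↦ J y (V y)) (fun y ↦ J y (W y)) x
    - J x (VectorField.mlieBracket 𝓘(ℝ, E) (fun y ↦ J y (V y)) W x)
    - J x (VectorField.mlieBracket 𝓘(ℝ, E) V (fun y ↦ J y (W y)) x)
    + J x (J x (VectorField.mlieBracket 𝓘(ℝ, E) V W x))

/-- Vanishing of the Nijenhuis tensor on all (locally defined) smooth vector fields. -/
def EndoField.IsIntegrable (J : EndoField (E := E) M) : Prop :=
  ∀ (x : M) (V W : ∀ y : M, TangentSpace 𝓘(ℝ, E) y),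
    ContMDiffAt 𝓘(ℝ, E) 𝓘(ℝ, E).tangent ∞
      (fun y ↦ (Bundle.TotalSpace.mk' E y (V y) : TangentBundle 𝓘(ℝ, E) M)) x →
    ContMDiffAt 𝓘(ℝ, E) 𝓘(ℝ, E).tangent ∞
      (fun y ↦ (Bundle.TotalSpace.mk' E y (W y) : TangentBundle 𝓘(ℝ, E) M)) x →
    J.nijenhuis V W x = 0

variable (M)

/-- A para-hypercomplex structure: three smooth integrable fields of endomorphisms with
`J₁² = -J₂² = -J₃² = -Id` and `J₁J₂ = -J₂J₁ = J₃`. -/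
structure ParaHypercomplex where
  J₁ : EndoField (E := E) M
  J₂ : EndoField (E := E) M
  J₃ : EndoField (E := E) M
  smooth₁ : J₁.IsSmooth
  smooth₂ : J₂.IsSmooth
  smooth₃ : J₃.IsSmooth
  sq₁ : ∀ x v, J₁ x (J₁ x v) = -v
  sq₂ : ∀ x v, J₂ x (J₂ x v) = v
  sq₃ : ∀ x v, J₃ x (J₃ x v) = v
  mul₁₂ : ∀ x v, J₁ x (J₂ x v) = J₃ x v
  mul₂₁ : ∀ x v, J₂ x (J₁ x v) = -J₃ x v
  integrable₁ : J₁.IsIntegrable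
  integrable₂ : J₂.IsIntegrable
  integrable₃ : J₃.IsIntegrable

/-- A pseudo-Riemannian metric of arbitrary signature: a smooth field of non-degenerate
symmetric bilinear forms on the tangent spaces. -/
structure PseudoRiemannianMetric where
  form : ∀ x : M, TangentSpace 𝓘(ℝ, E) x →L[ℝ] TangentSpace 𝓘(ℝ, E) x →L[ℝ] ℝ
  smooth : ContMDiff 𝓘(ℝ, E) (𝓘(ℝ, E).prod 𝓘(ℝ, E →L[ℝ] E →L[ℝ] ℝ)) ∞
    (fun x ↦ Bundle.TotalSpace.mk' (E →L[ℝ] E →L[ℝ] ℝ)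
      (E := fun x : M ↦ TangentSpace 𝓘(ℝ, E) x →L[ℝ] TangentSpace 𝓘(ℝ, E) x →L[ℝ] ℝ)
      x (form x))
  symm : ∀ x v w, form x v w = form x w v
  nondegenerate : ∀ x v, (∀ w, form x v w = 0) → v = 0

variable {M}

/-- `g(J₁v, J₁w) = -g(J₂v, J₂w) = -g(J₃v, J₃w) = g(v, w)`. -/
def PseudoRiemannianMetric.IsCompatible (g : PseudoRiemannianMetric (E := E) M)
    (P : ParaHypercomplex (E := E) M) : Prop :=
  ∀ x v w, g.form x (P.J₁ x v) (P.J₁ x w) = g.form x v w ∧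
    g.form x (P.J₂ x v) (P.J₂ x w) = -g.form x v w ∧
    g.form x (P.J₃ x v) (P.J₃ x w) = -g.form x v w

end ParaHypercomplex

/-! ### The covering space `ℍ × ℂ` and its affine transformations -/

namespace Inoue

/-- The product `ℍ × ℂ` of the upper half-plane and the complex plane, as an open subset of
`ℂ × ℂ`. -/
def HC : TopologicalSpace.Opens (ℂ × ℂ) :=
  ⟨{x | 0 < x.1.im}, isOpen_lt continuous_const (Complex.continuous_im.comp continuous_fst)⟩

/-- The transformation `(z, w) ↦ (s z + u, e w + β z + δ)` of `ℍ × ℂ`, where `s > 0`, `e = ±1`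
and `u`, `β`, `δ` are real. -/
noncomputable def aff (s : ℝ) (hs : 0 < s) (e : ℤˣ) (u β δ : ℝ) : Equiv.Perm HC where
  toFun x := ⟨(s * x.1.1 + u, ((e : ℤ) : ℂ) * x.1.2 + β * x.1.1 + δ), by
    have : 0 < x.1.1.im := x.2
    change 0 < Complex.im _
    simpa using mul_pos hs this⟩
  invFun x := ⟨(s⁻¹ * (x.1.1 - u), ((e : ℤ) : ℂ) * (x.1.2 - β * (s⁻¹ * (x.1.1 - u)) - δ)), by
    have : 0 < x.1.1.im := x.2
    change 0 < Complex.im _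
    have h := mul_pos (inv_pos.2 hs) this
    simpa using h⟩
  left_inv x := by
    have hs' : (s : ℂ) ≠ 0 := by exact_mod_cast hs.ne'
    apply Subtype.ext
    rcases Int.units_eq_one_or e with rfl | rfl <;> ext1 <;> simp <;> field_simp <;> ring
  right_inv x := by
    have hs' : (s : ℂ) ≠ 0 := by exact_mod_cast hs.ne'
    apply Subtype.ext
    rcases Int.units_eq_one_or e with rfl | rfl <;> ext1 <;> simp <;> field_simp <;> ring

theorem aff_val (s : ℝ) (hs : 0 < s) (e : ℤˣ) (u β δ : ℝ) (x : HC) :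
    (aff s hs e u β δ x).1 = (s * x.1.1 + u, ((e : ℤ) : ℂ) * x.1.2 + β * x.1.1 + δ) := rfl

theorem aff_mul (s s' : ℝ) (hs : 0 < s) (hs' : 0 < s') (e e' : ℤˣ) (u β δ u' β' δ' : ℝ) :
    aff s hs e u β δ * aff s' hs' e' u' β' δ' =
      aff (s * s') (mul_pos hs hs') (e * e') (s * u' + u) ((e : ℤ) * β' + β * s')
        ((e : ℤ) * δ' + β * u' + δ) := by
  ext1 x
  apply Subtype.ext
  rw [Equiv.Perm.mul_apply, aff_val, aff_val, aff_val]
  ext1 <;> push_cast <;> ring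

theorem aff_congr {s s' : ℝ} {hs : 0 < s} {hs' : 0 < s'} {e e' : ℤˣ} {u β δ u' β' δ' : ℝ}
    (h1 : s = s') (h2 : e = e') (h3 : u = u') (h4 : β = β') (h5 : δ = δ') :
    aff s hs e u β δ = aff s' hs' e' u' β' δ' := by
  subst h1 h2 h3 h4 h5; rfl

theorem aff_one : aff 1 one_pos 1 0 0 0 = 1 := by
  ext1 x
  apply Subtype.ext
  rw [aff_val]
  ext1 <;> simp

/-! ### The data and the groups defining the Inoue surfaces of type `S^±` -/

/-- The data defining an Inoue surface of type `S^+` with parameter `t = 0` (for `ε = 1`) or an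
Inoue surface of type `S^-` (for `ε = -1`): a matrix `N ∈ GL(2, ℤ)` with `det N = ε` and real
eigenvalues `α > 1` and `ε/α`, corresponding real eigenvectors `a` and `b`, integers `p`, `q`,
`r` with `r ≠ 0`, and the real solution `c` of the linear system
`ε c = N c + e + ((b₁a₂ - b₂a₁)/r) (p, q)`, where
`eᵢ = ½ nᵢ₁(nᵢ₁-1) a₁b₁ + ½ nᵢ₂(nᵢ₂-1) a₂b₂ + nᵢ₁nᵢ₂ b₁a₂`. The indices `1, 2` of the
mathematical notation are the indices `0, 1` of `Fin 2`. -/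
structure Data (ε : ℤˣ) where
  N : Matrix (Fin 2) (Fin 2) ℤ
  p : ℤ
  q : ℤ
  r : ℤ
  α : ℝ
  a : Fin 2 → ℝ
  b : Fin 2 → ℝ
  c : Fin 2 → ℝ
  r_ne_zero : r ≠ 0
  one_lt_α : 1 < α
  det_N : N.det = (ε : ℤ)
  a_ne_zero : a ≠ 0
  b_ne_zero : b ≠ 0
  N_mulVec_a : (N.map (Int.cast : ℤ → ℝ)).mulVec a = α • a
  N_mulVec_b : (N.map (Int.cast : ℤ → ℝ)).mulVec b = (((ε : ℤ) : ℝ) / α) • b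
  c_eq : ∀ i : Fin 2, ((ε : ℤ) : ℝ) * c i =
    (N i 0 * c 0 + N i 1 * c 1)
    + (1 / 2 * (N i 0 * (N i 0 - 1)) * a 0 * b 0 + 1 / 2 * (N i 1 * (N i 1 - 1)) * a 1 * b 1
        + N i 0 * N i 1 * b 0 * a 1)
    + (b 0 * a 1 - b 1 * a 0) / r * ((![p, q] i : ℤ) : ℝ)

namespace Data

variable {ε : ℤˣ} (D : Data ε)

/-- `A = (b₁a₂ - b₂a₁)/r`. -/
noncomputable def A : ℝ := (D.b 0 * D.a 1 - D.b 1 * D.a 0) / D.r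

theorem α_pos : 0 < D.α := one_pos.trans D.one_lt_α

/-- `φ₀(z, w) = (α z, ε w)`. -/
noncomputable def φ₀ : Equiv.Perm HC := aff D.α D.α_pos ε 0 0 0

/-- `φᵢ(z, w) = (z + aᵢ, w + bᵢ z + cᵢ)`, `i = 1, 2`. -/
noncomputable def φ (i : Fin 2) : Equiv.Perm HC := aff 1 one_pos 1 (D.a i) (D.b i) (D.c i)

/-- `φ₃(z, w) = (z, w + A)`. -/
noncomputable def φ₃ : Equiv.Perm HC := aff 1 one_pos 1 0 0 D.A

/-- The group of transformations of `ℍ × ℂ` generated by `φ₀, φ₁, φ₂, φ₃`. -/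
noncomputable def Γ : Subgroup (Equiv.Perm HC) :=
  Subgroup.closure {D.φ₀, D.φ 0, D.φ 1, D.φ₃}

/-! #### The group acts freely and properly discontinuously -/

theorem N_a (i : Fin 2) : D.N i 0 * D.a 0 + D.N i 1 * D.a 1 = D.α * D.a i := by
  have := congrFun D.N_mulVec_a i
  simpa [Matrix.mulVec, dotProduct, Fin.sum_univ_two] using this

theorem N_b (i : Fin 2) :
    D.N i 0 * D.b 0 + D.N i 1 * D.b 1 = ((ε : ℤ) : ℝ) / D.α * D.b i := by
  have := congrFun D.N_mulVec_b i
  simpa [Matrix.mulVec, dotProduct, Fin.sum_univ_two] using this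

theorem eps_sq : ((ε : ℤ) : ℝ) * ((ε : ℤ) : ℝ) = 1 := by
  rcases Int.units_eq_one_or ε with rfl | rfl <;> simp

/-- The eigenvectors `a` and `b` are linearly independent. -/
theorem det_ne_zero : D.b 0 * D.a 1 - D.b 1 * D.a 0 ≠ 0 := by
  intro h
  have hα := D.α_pos
  have h1 := D.one_lt_α
  have ea := D.N_a
  have eb := D.N_b
  have key : ∀ i, D.α * D.α * D.a i * D.b 0 = ((ε : ℤ) : ℝ) * D.b 0 * D.a i ∧
      D.α * D.α * D.a i * D.b 1 = ((ε : ℤ) : ℝ) * D.b 1 * D.a i := by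
    have e0 := ea 0
    have e1 := ea 1
    have f0 := eb 0
    have f1 := eb 1
    rw [div_mul_eq_mul_div, eq_div_iff hα.ne'] at f0 f1
    intro i
    fin_cases i
    · constructor
      · simp only [Fin.zero_eta, Fin.isValue]
        linear_combination (-D.α * D.b 0) * e0 + D.a 0 * f0 + (D.α * D.N 0 1) * h
      · simp only [Fin.zero_eta, Fin.isValue]
        linear_combination (-D.α * D.b 0) * e1 + D.a 0 * f1 + (D.α * D.N 1 1) * h
          - (D.α * D.α) * h
    · constructor
      · simp only [Fin.mk_one, Fin.isValue]
        linear_combination (-D.α * D.b 1) * e0 + D.a 1 * f0 - (D.α * D.N 0 0) * h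
          + (D.α * D.α) * h
      · simp only [Fin.mk_one, Fin.isValue]
        linear_combination (-D.α * D.b 1) * e1 + D.a 1 * f1 - (D.α * D.N 1 0) * h
  have hne : D.α * D.α - ((ε : ℤ) : ℝ) ≠ 0 := by
    rcases Int.units_eq_one_or ε with rfl | rfl <;> simp <;> nlinarith
  have z0 : ∀ i, D.a i * D.b 0 = 0 := fun i ↦ by
    have := (key i).1
    refine (mul_eq_zero.1 (?_ : (D.α * D.α - ((ε : ℤ) : ℝ)) * _ = 0)).resolve_left hne
    linear_combination this
  have z1 : ∀ i, D.a i * D.b 1 = 0 := fun i ↦ by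
    have := (key i).2
    refine (mul_eq_zero.1 (?_ : (D.α * D.α - ((ε : ℤ) : ℝ)) * _ = 0)).resolve_left hne
    linear_combination this
  apply D.a_ne_zero
  ext i
  by_contra hi
  apply D.b_ne_zero
  ext j
  fin_cases j
  · exact (mul_eq_zero.1 (z0 i)).resolve_left hi
  · exact (mul_eq_zero.1 (z1 i)).resolve_left hi

theorem A_ne_zero : D.A ≠ 0 :=
  div_ne_zero D.det_ne_zero (by exact_mod_cast D.r_ne_zero)

theorem r_mul_A : D.r * D.A = D.b 0 * D.a 1 - D.b 1 * D.a 0 :=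
  mul_div_cancel₀ _ (by exact_mod_cast D.r_ne_zero)

/-- The translation part of `φ₁ ^ m * φ₂ ^ n`. -/
noncomputable def h (m n : ℤ) : ℝ :=
  m * D.c 0 + n * D.c 1 + 1 / 2 * (m * (m - 1)) * D.a 0 * D.b 0
    + 1 / 2 * (n * (n - 1)) * D.a 1 * D.b 1 + m * n * D.b 0 * D.a 1

/-- The transformation `φ₁ ^ m * φ₂ ^ n * φ₃ ^ l * φ₀ ^ k`. -/
noncomputable def nf (m n l k : ℤ) : Equiv.Perm HC :=
  aff (D.α ^ k) (zpow_pos D.α_pos k) (ε ^ k) (m * D.a 0 + n * D.a 1)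
    ((m * D.b 0 + n * D.b 1) * D.α ^ k) (D.h m n + l * D.A)

theorem exists_h (m n : ℤ) : ∃ j : ℤ, ((ε : ℤ) : ℝ) * D.h m n =
    D.h (m * D.N 0 0 + n * D.N 1 0) (m * D.N 0 1 + n * D.N 1 1) + j * D.A := by
  have hα := D.α_pos
  have hr := D.r_mul_A
  have add : ∀ m n m' n' : ℤ,
      (∃ j : ℤ, ((ε : ℤ) : ℝ) * D.h m n =
        D.h (m * D.N 0 0 + n * D.N 1 0) (m * D.N 0 1 + n * D.N 1 1) + j * D.A) →
      (∃ j : ℤ, ((ε : ℤ) : ℝ) * D.h m' n' =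
        D.h (m' * D.N 0 0 + n' * D.N 1 0) (m' * D.N 0 1 + n' * D.N 1 1) + j * D.A) →
      ∃ j : ℤ, ((ε : ℤ) : ℝ) * D.h (m + m') (n + n') =
        D.h ((m + m') * D.N 0 0 + (n + n') * D.N 1 0)
          ((m + m') * D.N 0 1 + (n + n') * D.N 1 1) + j * D.A := by
    rintro m n m' n' ⟨j, hj⟩ ⟨j', hj'⟩
    have cocycle : ∀ m n m' n' : ℤ, D.h (m + m') (n + n') = D.h m n + D.h m' n'
        + (m * D.b 0 + n * D.b 1) * (m' * D.a 0 + n' * D.a 1) + D.r * D.A * n * m' := by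
      intro m n m' n'
      rw [hr]
      simp only [h]
      push_cast
      ring
    have e1 : (m + m') * D.N 0 0 + (n + n') * D.N 1 0 =
        (m * D.N 0 0 + n * D.N 1 0) + (m' * D.N 0 0 + n' * D.N 1 0) := by ring
    have e2 : (m + m') * D.N 0 1 + (n + n') * D.N 1 1 =
        (m * D.N 0 1 + n * D.N 1 1) + (m' * D.N 0 1 + n' * D.N 1 1) := by ring
    rw [e1, e2, cocycle, cocycle]
    have eb : ((m * D.N 0 0 + n * D.N 1 0 : ℤ) : ℝ) * D.b 0
        + ((m * D.N 0 1 + n * D.N 1 1 : ℤ) : ℝ) * D.b 1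
        = ((ε : ℤ) : ℝ) / D.α * (m * D.b 0 + n * D.b 1) := by
      push_cast
      linear_combination m * D.N_b 0 + n * D.N_b 1
    have ea : ((m' * D.N 0 0 + n' * D.N 1 0 : ℤ) : ℝ) * D.a 0
        + ((m' * D.N 0 1 + n' * D.N 1 1 : ℤ) : ℝ) * D.a 1
        = D.α * (m' * D.a 0 + n' * D.a 1) := by
      push_cast
      linear_combination m' * D.N_a 0 + n' * D.N_a 1
    rw [eb, ea]
    refine ⟨j + j' + (ε : ℤ) * D.r * n * m'
      - D.r * (m * D.N 0 1 + n * D.N 1 1) * (m' * D.N 0 0 + n' * D.N 1 0), ?_⟩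
    have : ((ε : ℤ) : ℝ) / D.α * (m * D.b 0 + n * D.b 1) * (D.α * (m' * D.a 0 + n' * D.a 1))
        = ((ε : ℤ) : ℝ) * ((m * D.b 0 + n * D.b 1) * (m' * D.a 0 + n' * D.a 1)) := by
      field_simp
    rw [this]
    push_cast
    linear_combination hj + hj'
  have neg : ∀ m n : ℤ,
      (∃ j : ℤ, ((ε : ℤ) : ℝ) * D.h m n =
        D.h (m * D.N 0 0 + n * D.N 1 0) (m * D.N 0 1 + n * D.N 1 1) + j * D.A) →
      ∃ j : ℤ, ((ε : ℤ) : ℝ) * D.h (-m) (-n) =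
        D.h (-m * D.N 0 0 + -n * D.N 1 0) (-m * D.N 0 1 + -n * D.N 1 1) + j * D.A := by
    rintro m n ⟨j, hj⟩
    have cocycle : ∀ m n : ℤ, D.h (-m) (-n) = - D.h m n
        + (m * D.b 0 + n * D.b 1) * (m * D.a 0 + n * D.a 1) + D.r * D.A * n * m := by
      intro m n
      rw [hr]
      simp only [h]
      push_cast
      ring
    have e1 : -m * D.N 0 0 + -n * D.N 1 0 = -(m * D.N 0 0 + n * D.N 1 0) := by ring
    have e2 : -m * D.N 0 1 + -n * D.N 1 1 = -(m * D.N 0 1 + n * D.N 1 1) := by ring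
    rw [e1, e2, cocycle, cocycle]
    have eb : ((m * D.N 0 0 + n * D.N 1 0 : ℤ) : ℝ) * D.b 0
        + ((m * D.N 0 1 + n * D.N 1 1 : ℤ) : ℝ) * D.b 1
        = ((ε : ℤ) : ℝ) / D.α * (m * D.b 0 + n * D.b 1) := by
      push_cast
      linear_combination m * D.N_b 0 + n * D.N_b 1
    have ea : ((m * D.N 0 0 + n * D.N 1 0 : ℤ) : ℝ) * D.a 0
        + ((m * D.N 0 1 + n * D.N 1 1 : ℤ) : ℝ) * D.a 1
        = D.α * (m * D.a 0 + n * D.a 1) := by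
      push_cast
      linear_combination m * D.N_a 0 + n * D.N_a 1
    rw [eb, ea]
    refine ⟨-j + (ε : ℤ) * D.r * n * m
      - D.r * (m * D.N 0 1 + n * D.N 1 1) * (m * D.N 0 0 + n * D.N 1 0), ?_⟩
    have : ((ε : ℤ) : ℝ) / D.α * (m * D.b 0 + n * D.b 1) * (D.α * (m * D.a 0 + n * D.a 1))
        = ((ε : ℤ) : ℝ) * ((m * D.b 0 + n * D.b 1) * (m * D.a 0 + n * D.a 1)) := by
      field_simp
    rw [this]
    push_cast
    linear_combination -hj
  have one : ∃ j : ℤ, ((ε : ℤ) : ℝ) * D.h 1 0 =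
        D.h (1 * D.N 0 0 + 0 * D.N 1 0) (1 * D.N 0 1 + 0 * D.N 1 1) + j * D.A := by
    refine ⟨D.p, ?_⟩
    have := D.c_eq 0
    simp only [h, A]
    simp at this ⊢
    linear_combination this
  have two : ∃ j : ℤ, ((ε : ℤ) : ℝ) * D.h 0 1 =
        D.h (0 * D.N 0 0 + 1 * D.N 1 0) (0 * D.N 0 1 + 1 * D.N 1 1) + j * D.A := by
    refine ⟨D.q, ?_⟩
    have := D.c_eq 1
    simp only [h, A]
    simp at this ⊢
    linear_combination this
  have zero : ∃ j : ℤ, ((ε : ℤ) : ℝ) * D.h 0 0 =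
        D.h (0 * D.N 0 0 + 0 * D.N 1 0) (0 * D.N 0 1 + 0 * D.N 1 1) + j * D.A :=
    ⟨0, by simp [h]⟩
  have left : ∀ m : ℤ, ∃ j : ℤ, ((ε : ℤ) : ℝ) * D.h m 0 =
        D.h (m * D.N 0 0 + 0 * D.N 1 0) (m * D.N 0 1 + 0 * D.N 1 1) + j * D.A := by
    intro m
    induction m using Int.induction_on with
    | zero => exact zero
    | succ i ih => simpa using add _ _ _ _ ih one
    | pred i ih => simpa [sub_eq_add_neg] using add _ _ _ _ ih (neg _ _ one)
  have right : ∀ n : ℤ, ∃ j : ℤ, ((ε : ℤ) : ℝ) * D.h 0 n =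
        D.h (0 * D.N 0 0 + n * D.N 1 0) (0 * D.N 0 1 + n * D.N 1 1) + j * D.A := by
    intro n
    induction n using Int.induction_on with
    | zero => exact zero
    | succ i ih => simpa using add _ _ _ _ ih two
    | pred i ih => simpa [sub_eq_add_neg] using add _ _ _ _ ih (neg _ _ two)
  simpa using add _ _ _ _ (left m) (right n)

/-- Every element of the group has the form `φ₁ ^ m * φ₂ ^ n * φ₃ ^ l * φ₀ ^ k`. -/
theorem exists_nf {γ : Equiv.Perm HC} (hγ : γ ∈ D.Γ) : ∃ m n l k : ℤ, γ = D.nf m n l k := by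
  have hr := D.r_mul_A
  have hα := D.α_pos
  induction hγ using Subgroup.closure_induction_left with
  | one =>
    refine ⟨0, 0, 0, 0, ?_⟩
    rw [← aff_one]
    apply aff_congr <;> simp [h]
  | mul_left x hx y hy ih =>
    obtain ⟨m, n, l, k, rfl⟩ := ih
    rcases hx with rfl | rfl | rfl | rfl
    · obtain ⟨j, hj⟩ := D.exists_h m n
      refine ⟨m * D.N 0 0 + n * D.N 1 0, m * D.N 0 1 + n * D.N 1 1, j + (ε : ℤ) * l, k + 1, ?_⟩
      rw [φ₀, nf, nf, aff_mul]
      apply aff_congr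
      · rw [zpow_add_one₀ hα.ne', mul_comm]
      · rw [zpow_add_one, mul_comm]
      · push_cast
        linear_combination -m * D.N_a 0 - n * D.N_a 1
      · push_cast
        have e : ((m : ℝ) * D.N 0 0 + n * D.N 1 0) * D.b 0 + (m * D.N 0 1 + n * D.N 1 1) * D.b 1
            = ((ε : ℤ) : ℝ) / D.α * (m * D.b 0 + n * D.b 1) := by
          linear_combination m * D.N_b 0 + n * D.N_b 1
        rw [e, zpow_add_one₀ hα.ne']
        field_simp
        ring
      · push_cast
        linear_combination hj
    · refine ⟨m + 1, n, l, k, ?_⟩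
      rw [φ, nf, nf, aff_mul]
      apply aff_congr <;> simp [h] <;> ring
    · refine ⟨m, n + 1, l - D.r * m, k, ?_⟩
      rw [φ, nf, nf, aff_mul]
      apply aff_congr
      · simp
      · simp
      · push_cast; ring
      · simp; ring
      · simp [h]
        linear_combination m * hr
    · refine ⟨m, n, l + 1, k, ?_⟩
      rw [φ₃, nf, nf, aff_mul]
      apply aff_congr <;> simp <;> ring
  | inv_mul_cancel x hx y hy ih =>
    obtain ⟨m, n, l, k, rfl⟩ := ih
    rcases hx with rfl | rfl | rfl | rfl
    · have hd := D.det_N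
      rw [Matrix.det_fin_two] at hd
      have hee : (ε : ℤ) * (ε : ℤ) = 1 := by
        rcases Int.units_eq_one_or ε with rfl | rfl <;> simp
      obtain ⟨m', n', rfl, rfl⟩ : ∃ m' n' : ℤ, m = m' * D.N 0 0 + n' * D.N 1 0 ∧
          n = m' * D.N 0 1 + n' * D.N 1 1 := by
        refine ⟨(ε : ℤ) * (m * D.N 1 1 - n * D.N 1 0),
          (ε : ℤ) * (n * D.N 0 0 - m * D.N 0 1), ?_, ?_⟩
        · linear_combination -m * hee - (ε : ℤ) * m * hd
        · linear_combination -n * hee - (ε : ℤ) * n * hd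
      obtain ⟨j, hj⟩ := D.exists_h m' n'
      refine ⟨m', n', (ε : ℤ) * (l - j), k - 1, ?_⟩
      rw [inv_mul_eq_iff_eq_mul, φ₀, nf, nf, aff_mul]
      apply aff_congr
      · rw [zpow_sub_one₀ hα.ne']
        field_simp
      · rw [zpow_sub_one, mul_left_comm, mul_inv_cancel, mul_one]
      · push_cast
        linear_combination m' * D.N_a 0 + n' * D.N_a 1
      · push_cast
        have e : ((m' : ℝ) * D.N 0 0 + n' * D.N 1 0) * D.b 0
            + (m' * D.N 0 1 + n' * D.N 1 1) * D.b 1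
            = ((ε : ℤ) : ℝ) / D.α * (m' * D.b 0 + n' * D.b 1) := by
          linear_combination m' * D.N_b 0 + n' * D.N_b 1
        rw [e, zpow_sub_one₀ hα.ne']
        field_simp
        ring
      · push_cast
        linear_combination -hj - (l - j) * D.A * (eps_sq (ε := ε))
    · refine ⟨m - 1, n, l, k, ?_⟩
      rw [inv_mul_eq_iff_eq_mul, φ, nf, nf, aff_mul]
      apply aff_congr <;> simp [h] <;> ring
    · refine ⟨m, n - 1, l + D.r * m, k, ?_⟩
      rw [inv_mul_eq_iff_eq_mul, φ, nf, nf, aff_mul]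
      apply aff_congr
      · simp
      · simp
      · push_cast; ring
      · simp; ring
      · simp [h]
        linear_combination -m * hr
    · refine ⟨m, n, l - 1, k, ?_⟩
      rw [inv_mul_eq_iff_eq_mul, φ₃, nf, nf, aff_mul]
      apply aff_congr <;> simp <;> ring

theorem continuous_aff (s : ℝ) (hs : 0 < s) (e : ℤˣ) (u β δ : ℝ) :
    Continuous (aff s hs e u β δ) := by
  refine Continuous.subtype_mk ?_ _
  fun_prop

instance : ContinuousConstSMul D.Γ HC where
  continuous_const_smul γ := by
    obtain ⟨m, n, l, k, h⟩ := D.exists_nf γ.2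
    change Continuous (γ : Equiv.Perm HC)
    rw [h]
    exact continuous_aff _ _ _ _ _ _

set_option maxHeartbeats 1000000 in
theorem exists_nhds_disjoint (x : HC) :
    ∃ U ∈ 𝓝 x, ∀ γ : D.Γ, ((γ • ·) '' U ∩ U).Nonempty → γ = 1 := by
  have hα := D.α_pos
  have h1 := D.one_lt_α
  have hx : 0 < x.1.1.im := x.2
  set y := x.1.1.im with hy
  set d := D.b 0 * D.a 1 - D.b 1 * D.a 0 with hd
  have hd0 : 0 < |d| := abs_pos.2 D.det_ne_zero
  have hA0 : 0 < |D.A| := abs_pos.2 D.A_ne_zero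
  set C := |D.a 0| + |D.a 1| + |D.b 0| + |D.b 1| + 1 with hC
  have hC0 : 0 < C := by positivity
  -- bounds on the real number `t` measuring the size of the neighbourhood
  obtain ⟨t, ht0, ht1, ht2, ht3, ht4⟩ : ∃ t : ℝ, 0 < t ∧ t < y / 2 ∧ (1 + D.α) * t < (D.α - 1) * y
      ∧ 2 * t * C * (1 + 2 / y) < |d| ∧ 2 * t < |D.A| := by
    have e1 : 0 < y / 2 := by positivity
    have e2 : 0 < (D.α - 1) * y / (1 + D.α) := by
      have : 0 < D.α - 1 := by linarith
      positivity
    have e3 : 0 < |d| / (2 * C * (1 + 2 / y)) := by positivity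
    have e4 : 0 < |D.A| / 2 := by positivity
    obtain ⟨t, ht0, ht⟩ := exists_between (lt_min (lt_min e1 e2) (lt_min e3 e4))
    simp only [lt_min_iff] at ht
    refine ⟨t, ht0, ht.1.1, ?_, ?_, by linarith [ht.2.2]⟩
    · have := (lt_div_iff₀ (by positivity)).1 ht.1.2
      linarith
    · have := (lt_div_iff₀ (by positivity)).1 ht.2.1
      linarith
  refine ⟨Metric.ball x t, Metric.ball_mem_nhds x ht0, ?_⟩
  rintro γ ⟨v', ⟨v, hv, rfl⟩, hv'⟩
  obtain ⟨m, n, l, k, h⟩ := D.exists_nf γ.2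
  have hsm : (γ • v : HC) = D.nf m n l k v := by
    rw [← h]; rfl
  simp only [hsm] at hv'
  have dist_bounds : ∀ v ∈ Metric.ball x t, ‖v.1.1 - x.1.1‖ < t ∧ ‖v.1.2 - x.1.2‖ < t := by
    intro v hv
    have : dist v.1 x.1 < t := hv
    rw [Prod.dist_eq, max_lt_iff, dist_eq_norm, dist_eq_norm] at this
    exact this
  obtain ⟨hv1, hv2⟩ := dist_bounds v hv
  obtain ⟨hw1, hw2⟩ := dist_bounds _ hv'
  set w := D.nf m n l k v with hw
  have im1 : |v.1.1.im - y| < t := lt_of_le_of_lt (Complex.abs_im_le_norm (v.1.1 - x.1.1)) hv1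
  have im2 : |w.1.1.im - y| < t := lt_of_le_of_lt (Complex.abs_im_le_norm (w.1.1 - x.1.1)) hw1
  rw [abs_lt] at im1 im2
  have wim : w.1.1.im = D.α ^ k * v.1.1.im := by
    rw [hw, nf, aff_val]
    simp only [Complex.add_im, Complex.im_ofReal_mul, Complex.ofReal_im, add_zero]
  have hk : k = 0 := by
    by_contra hk
    rcases lt_or_gt_of_ne hk with hk | hk
    · have e : D.α ^ k ≤ D.α ^ (-1 : ℤ) := zpow_le_zpow_right₀ h1.le (by omega)
      rw [zpow_neg_one] at e
      have : w.1.1.im ≤ D.α⁻¹ * v.1.1.im := by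
        rw [wim]
        exact mul_le_mul_of_nonneg_right e (by linarith)
      have : D.α * w.1.1.im ≤ v.1.1.im := by
        calc D.α * w.1.1.im ≤ D.α * (D.α⁻¹ * v.1.1.im) := mul_le_mul_of_nonneg_left this hα.le
          _ = v.1.1.im := by field_simp
      nlinarith
    · have e : D.α ^ (1 : ℤ) ≤ D.α ^ k := zpow_le_zpow_right₀ h1.le (by omega)
      rw [zpow_one] at e
      have : D.α * v.1.1.im ≤ w.1.1.im := by
        rw [wim]
        exact mul_le_mul_of_nonneg_right e (by linarith)
      nlinarith
  subst hk
  have w1 : w.1.1 = v.1.1 + ((m * D.a 0 + n * D.a 1 : ℝ) : ℂ) := by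
    rw [hw, nf, aff_val]; simp
  have w2 : w.1.2 = v.1.2 + ((m * D.b 0 + n * D.b 1 : ℝ) : ℂ) * v.1.1
      + ((D.h m n + l * D.A : ℝ) : ℂ) := by
    rw [hw, nf, aff_val]; simp
  have ba : |m * D.a 0 + n * D.a 1| < 2 * t := by
    have : ((m * D.a 0 + n * D.a 1 : ℝ) : ℂ) = (w.1.1 - x.1.1) - (v.1.1 - x.1.1) := by
      rw [w1]; ring
    rw [← Real.norm_eq_abs, ← Complex.norm_real, this]
    linarith [norm_sub_le (w.1.1 - x.1.1) (v.1.1 - x.1.1)]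
  have bw : ‖w.1.2 - v.1.2‖ < 2 * t := by
    have : w.1.2 - v.1.2 = (w.1.2 - x.1.2) - (v.1.2 - x.1.2) := by ring
    rw [this]
    linarith [norm_sub_le (w.1.2 - x.1.2) (v.1.2 - x.1.2)]
  have bb : |m * D.b 0 + n * D.b 1| < 2 * t * (2 / y) := by
    have e : (w.1.2 - v.1.2).im = (m * D.b 0 + n * D.b 1) * v.1.1.im := by
      rw [w2]
      simp only [Complex.sub_im, Complex.add_im, Complex.im_ofReal_mul,
        Complex.ofReal_im]
      ring
    have e' := lt_of_le_of_lt (Complex.abs_im_le_norm (w.1.2 - v.1.2)) bw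
    have hv0 : y / 2 < v.1.1.im := by linarith
    rw [e, abs_mul, abs_of_pos (lt_trans (by positivity) hv0)] at e'
    rw [mul_div_assoc', lt_div_iff₀ hx]
    nlinarith [abs_nonneg (m * D.b 0 + n * D.b 1)]
  have int_zero : ∀ j : ℤ, |j * d| < |d| → j = 0 := by
    intro j hj
    rw [abs_mul] at hj
    have : |(j : ℝ)| < 1 := by
      by_contra hc
      nlinarith
    rw [← Int.cast_abs] at this
    have : |j| < 1 := by exact_mod_cast this
    exact Int.abs_lt_one_iff.1 this
  have bound : ∀ s s' : ℝ, |s| ≤ C → |s'| ≤ C →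
      |s * (m * D.a 0 + n * D.a 1) + s' * (m * D.b 0 + n * D.b 1)| < |d| := by
    intro s s' hs hs'
    calc _ ≤ |s * (m * D.a 0 + n * D.a 1)| + |s' * (m * D.b 0 + n * D.b 1)| := abs_add_le _ _
      _ ≤ C * (2 * t) + C * (2 * t * (2 / y)) := by
        rw [abs_mul, abs_mul]
        gcongr
      _ = 2 * t * C * (1 + 2 / y) := by ring
      _ < |d| := ht3
  have hm : m = 0 := by
    apply int_zero
    have : m * d = -D.b 1 * (m * D.a 0 + n * D.a 1) + D.a 1 * (m * D.b 0 + n * D.b 1) := by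
      rw [hd]; ring
    rw [this]
    apply bound
    · rw [abs_neg, hC]
      linarith [abs_nonneg (D.a 0), abs_nonneg (D.a 1), abs_nonneg (D.b 0), abs_nonneg (D.b 1)]
    · rw [hC]
      linarith [abs_nonneg (D.a 0), abs_nonneg (D.a 1), abs_nonneg (D.b 0), abs_nonneg (D.b 1)]
  have hn : n = 0 := by
    apply int_zero
    have : n * d = D.b 0 * (m * D.a 0 + n * D.a 1) + -D.a 0 * (m * D.b 0 + n * D.b 1) := by
      rw [hd]; ring
    rw [this]
    apply bound
    · rw [hC]
      linarith [abs_nonneg (D.a 0), abs_nonneg (D.a 1), abs_nonneg (D.b 0), abs_nonneg (D.b 1)]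
    · rw [abs_neg, hC]
      linarith [abs_nonneg (D.a 0), abs_nonneg (D.a 1), abs_nonneg (D.b 0), abs_nonneg (D.b 1)]
  subst hm hn
  have hl : l = 0 := by
    have e : w.1.2 - v.1.2 = ((l * D.A : ℝ) : ℂ) := by
      rw [w2]; simp [Data.h]
    rw [e, Complex.norm_real, Real.norm_eq_abs, abs_mul] at bw
    have : |(l : ℝ)| < 1 := by
      by_contra hc
      nlinarith
    rw [← Int.cast_abs] at this
    have : |l| < 1 := by exact_mod_cast this
    exact Int.abs_lt_one_iff.1 this
  subst hl
  apply Subtype.ext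
  rw [h, Subgroup.coe_one, ← aff_one]
  apply aff_congr <;> simp [Data.h]

/-! ### The surfaces -/

/-- The Inoue surface: the quotient of `ℍ × ℂ` by the action of the group. -/
def Surface : Type := MulAction.orbitRel.Quotient D.Γ HC

instance : TopologicalSpace D.Surface :=
  inferInstanceAs (TopologicalSpace (MulAction.orbitRel.Quotient D.Γ HC))

/-- The projection `ℍ × ℂ → S`. -/
noncomputable def proj (x : HC) : D.Surface := Quotient.mk (MulAction.orbitRel D.Γ HC) x

theorem isQuotientCoveringMap_proj : IsQuotientCoveringMap D.proj D.Γ where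
  __ := (isQuotientMap_quotient_mk' : Topology.IsQuotientMap (Quotient.mk (MulAction.orbitRel D.Γ HC)))
  apply_eq_iff_mem_orbit := Quotient.eq''
  disjoint := D.exists_nhds_disjoint

theorem isLocalHomeomorph_proj : IsLocalHomeomorph D.proj :=
  D.isQuotientCoveringMap_proj.isCoveringMap.isLocalHomeomorph

theorem surjective_proj : Function.Surjective D.proj := D.isQuotientCoveringMap_proj.surjective

/-- The charts of the surface are the local inverses of the projection from `ℍ × ℂ ⊆ ℂ × ℂ`. -/
noncomputable instance : ChartedSpace (ℂ × ℂ) D.Surface :=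
  D.isLocalHomeomorph_proj.chartedSpace D.surjective_proj

theorem isManifold (𝕜 : Type) [NontriviallyNormedField 𝕜] [NormedAlgebra 𝕜 ℂ] (n : ℕ∞ω) :
    IsManifold 𝓘(𝕜, ℂ × ℂ) n D.Surface := by
  apply isManifold_of_contDiffOn
  rintro e e' ⟨q, rfl⟩ ⟨q', rfl⟩
  set L := D.isLocalHomeomorph_proj.localInverseAt (D.surjective_proj.hasRightInverse.choose q)
    with hL
  set L' := D.isLocalHomeomorph_proj.localInverseAt (D.surjective_proj.hasRightInverse.choose q')
    with hL'
  have hLs : ∀ x, L.symm x = D.proj x := fun x ↦ by rw [hL, IsLocalHomeomorph.localInverseAt_symm]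
  have hLs' : ∀ x, L'.symm x = D.proj x := fun x ↦ by
    rw [hL', IsLocalHomeomorph.localInverseAt_symm]
  have hc : ∀ x y : HC, chartAt (ℂ × ℂ) x y = y.1 := fun x y ↦ rfl
  have hcs : ∀ x y : HC, (chartAt (ℂ × ℂ) x).symm y.1 = y := fun x y ↦ by
    rw [← hc x y]
    apply (chartAt (ℂ × ℂ) x).left_inv
    rw [TopologicalSpace.Opens.chartAt_eq, OpenPartialHomeomorph.subtypeRestr_source]
    exact Set.mem_univ _
  rintro v ⟨hv, -⟩
  set x₀ := D.surjective_proj.hasRightInverse.choose q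
  set x₀' := D.surjective_proj.hasRightInverse.choose q'
  have hv' : v ∈ ((L.trans (chartAt (ℂ × ℂ) x₀)).symm.trans
      (L'.trans (chartAt (ℂ × ℂ) x₀'))).source := hv
  rw [OpenPartialHomeomorph.trans_source] at hv'
  obtain ⟨hv1, hv2⟩ := hv'
  rw [OpenPartialHomeomorph.symm_source, OpenPartialHomeomorph.trans_target] at hv1
  obtain ⟨hv1, -⟩ := hv1
  rw [Set.mem_preimage, OpenPartialHomeomorph.trans_source] at hv2
  obtain ⟨hv2, -⟩ := hv2
  set x : HC := (chartAt (ℂ × ℂ) x₀).symm v with hx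
  have hxv : x.1 = v := by
    rw [← hc x₀ x, hx]
    exact (chartAt (ℂ × ℂ) x₀).right_inv hv1
  replace hv2 : D.proj x ∈ L'.source := by
    rw [← hLs]
    exact hv2
  have hy : D.proj (L' (D.proj x)) = D.proj x := by
    rw [← hLs', L'.left_inv hv2]
  obtain ⟨γ, hγ⟩ := D.isQuotientCoveringMap_proj.apply_eq_iff_mem_orbit.1 hy
  replace hγ : γ • x = L' (D.proj x) := hγ
  obtain ⟨i, j, l, k, hnf⟩ := D.exists_nf γ.2
  have hsm : ∀ u : HC, (γ • u : HC) = D.nf i j l k u := fun u ↦ by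
    rw [← hnf]; rfl
  have hG : ContDiff 𝕜 n (fun u : ℂ × ℂ ↦ (((D.α ^ k : ℝ) : ℂ) * u.1
      + ((i * D.a 0 + j * D.a 1 : ℝ) : ℂ), (((ε ^ k : ℤˣ) : ℤ) : ℂ) * u.2
      + (((i * D.b 0 + j * D.b 1) * D.α ^ k : ℝ) : ℂ) * u.1
      + ((D.h i j + l * D.A : ℝ) : ℂ))) := by
    fun_prop
  refine (hG.contDiffAt.congr_of_eventuallyEq ?_).contDiffWithinAt
  have hT : (fun u : HC ↦ γ • u) ⁻¹' L'.target ∈ 𝓝 x := by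
    refine (continuous_const_smul γ).continuousAt.preimage_mem_nhds ?_
    rw [hγ]
    exact L'.open_target.mem_nhds (L'.map_source hv2)
  have hT' := HC.isOpen.isOpenMap_subtype_val.image_mem_nhds hT
  rw [hxv] at hT'
  filter_upwards [hT']
  rintro _ ⟨u, hu, rfl⟩
  have e1 : L.symm ((chartAt (ℂ × ℂ) x₀).symm u.1) = L'.symm (γ • u) := by
    rw [hcs, hLs, hLs', D.isQuotientCoveringMap_proj.map_smul]
  have e2 : L' (L.symm ((chartAt (ℂ × ℂ) x₀).symm u.1)) = γ • u := by
    rw [e1, L'.right_inv hu]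
  change (L' (L.symm ((chartAt (ℂ × ℂ) x₀).symm u.1))).1 = _
  rw [e2, hsm]
  rfl

/-- The surface is a complex manifold. -/
instance : IsManifold 𝓘(ℂ, ℂ × ℂ) ω D.Surface := D.isManifold ℂ ω

/-- The surface is a smooth real manifold. -/
instance : IsManifold 𝓘(ℝ, ℂ × ℂ) ∞ D.Surface := D.isManifold ℝ ∞

end Data

/-! ### The invariant forms on `ℍ × ℂ`

The forms are evaluated at `x = (z, w)` on tangent vectors `u, v ∈ ℂ × ℂ` written in the
coordinates `(z, w)`; the convention is `(φ ∧ ψ)(u, v) = φ(u) ψ(v) - φ(v) ψ(u)`. -/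

/-- `θ₁ = dz / Im z`. -/
noncomputable def θ₁ (x : HC) (u : ℂ × ℂ) : ℂ := u.1 / (x.1.1.im : ℂ)

/-- `θ₂ = dw - (Im w / Im z) dz`. -/
noncomputable def θ₂ (x : HC) (u : ℂ × ℂ) : ℂ := u.2 - (x.1.2.im : ℂ) / (x.1.1.im : ℂ) * u.1

/-- `Ω = θ₁ ∧ θ₂`. -/
noncomputable def Ω (x : HC) (u v : ℂ × ℂ) : ℂ := θ₁ x u * θ₂ x v - θ₁ x v * θ₂ x u

/-- `Ω₁ = Re (θ₁ ∧ conj θ₂)`. -/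
noncomputable def Ω₁ (x : HC) (u v : ℂ × ℂ) : ℝ :=
  (θ₁ x u * (starRingEnd ℂ) (θ₂ x v) - θ₁ x v * (starRingEnd ℂ) (θ₂ x u)).re

/-! ### Endomorphism fields and maps -/

/-- The complex structure of a complex surface `M`, seen as a field of real endomorphisms of the
tangent spaces: multiplication by `i` (in any holomorphic chart). -/
noncomputable def complexStructure (M : Type*) [TopologicalSpace M] [ChartedSpace (ℂ × ℂ) M]
    [IsManifold 𝓘(ℂ, ℂ × ℂ) ω M] : EndoField (E := ℂ × ℂ) M :=
  fun _ ↦ (Complex.I • ContinuousLinearMap.id ℝ (ℂ × ℂ) : (ℂ × ℂ) →L[ℝ] (ℂ × ℂ))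

/-- `J' ∘ dκ = dκ ∘ J`: the endomorphism fields `J` and `J'` are related by the map `κ`. -/
def Related {M M' : Type*} [TopologicalSpace M] [ChartedSpace (ℂ × ℂ) M]
    [TopologicalSpace M'] [ChartedSpace (ℂ × ℂ) M'] (κ : M → M')
    (J : EndoField (E := ℂ × ℂ) M) (J' : EndoField (E := ℂ × ℂ) M') : Prop :=
  ∀ (m : M) (v : TangentSpace 𝓘(ℝ, ℂ × ℂ) m),
    J' (κ m) (mfderiv 𝓘(ℝ, ℂ × ℂ) 𝓘(ℝ, ℂ × ℂ) κ m v)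
      = mfderiv 𝓘(ℝ, ℂ × ℂ) 𝓘(ℝ, ℂ × ℂ) κ m (J m v)

end Inoue

/-!
The group `Γ` acts on `ℍ × ℂ` by affine maps with linear part `(z, w) ↦ (s z, e w + β z)`, where
`s > 0` and `β` are real and `e` is a power of `ε`. The endomorphisms `i`, `i conj` and `-conj` of
`ℂ × ℂ` commute with these, so they descend to constant, hence integrable, fields on the surfaces.
The neutral form `g = (Im z)⁻¹ Im (u₁ conj v₂ + v₁ conj u₂)` is multiplied by `e`: for `ε = 1` it
descends, and for `ε = -1` it changes sign under `φ₀`. The group of the surface belonging to `N²`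
is the subgroup of index two in `Γ` of the elements with an even power of `φ₀`, and `φ₀` induces the
covering involution `σ`, which is therefore an anti-isometry of `g`.

The pullback to `ℍ × ℂ` of a metric on `S⁻` compatible with the structure would pair the constant
fields `(1, 0)` and `(0, i)` to a nowhere vanishing continuous function, because compatibility makes
`(1, 0)` orthogonal to `(1, 0)`, `(i, 0)` and `(0, 1)`. But `φ₀` reverses the sign of this function,
which contradicts the connectedness of `ℍ × ℂ`.
-/

section Coverings

variable {X Y : Type*} [TopologicalSpace X] [TopologicalSpace Y]

theorem exists_eventually_localInverseAt_eq_smul {G : Type*} [Group G] [MulAction G X] {p : X → Y}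
    (hp : IsQuotientCoveringMap p G) (hp' : IsLocalHomeomorph p) {x₀ x : X}
    (hx : p x ∈ (hp'.localInverseAt x₀).source) :
    ∃ g : G, ∀ᶠ u in 𝓝 x, hp'.localInverseAt x₀ (p u) = g • u := by
  have := hp.toContinuousConstSMul
  set L := hp'.localInverseAt x₀
  obtain ⟨g, hg⟩ := hp.apply_eq_iff_mem_orbit.1 (hp'.apply_localInverseAt_of_mem hx)
  replace hg : g • x = L (p x) := hg
  have htarget : ∀ᶠ u in 𝓝 x, g • u ∈ L.target := by
    refine (continuous_const_smul g).continuousAt.eventually_mem (L.open_target.mem_nhds ?_)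
    rw [hg]
    exact L.map_source hx
  refine ⟨g, htarget.mono fun u hu ↦ ?_⟩
  have hpu : p u = L.symm (g • u) := by rw [hp'.localInverseAt_symm, hp.map_smul]
  rw [hpu, L.right_inv hu]

theorem eq_one_or_eq_of_mem_zpowers {G : Type*} [Group G] {s g : G} (hs : s * s = 1)
    (hg : g ∈ Subgroup.zpowers s) : g = 1 ∨ g = s := by
  obtain ⟨k, rfl⟩ := hg
  have hs2 : s ^ (2 : ℤ) = 1 := (zpow_two s).trans hs
  rcases Int.even_or_odd' k with ⟨j, rfl | rfl⟩
  · exact Or.inl (by simp only [zpow_mul, hs2, one_zpow])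
  · exact Or.inr (by simp only [zpow_add, zpow_mul, hs2, one_zpow, one_mul, zpow_one])

theorem isCoveringMap_of_involutive {κ : X → Y} {σ : X → X} (hκ : Topology.IsQuotientMap κ)
    (hσ : Continuous σ) (hσσ : Function.Involutive σ)
    (hfibre : ∀ x x', κ x = κ x' ↔ x' = x ∨ x' = σ x)
    (hdisj : ∀ x, ∃ U ∈ 𝓝 x, Disjoint (σ '' U) U) : IsCoveringMap κ := by
  let s : Equiv.Perm X := hσσ.toPerm σ
  have hs (g : Subgroup.zpowers s) : (∀ x : X, g • x = x) ∨ ∀ x : X, g • x = σ x := by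
    rcases eq_one_or_eq_of_mem_zpowers (Equiv.ext hσσ : s * s = 1) g.2 with h | h
    · exact Or.inl fun x ↦ congrArg (· x) h
    · exact Or.inr fun x ↦ congrArg (· x) h
  have hquot : IsQuotientCoveringMap κ (Subgroup.zpowers s) :=
    { hκ with
      continuous_const_smul := fun g ↦ by
        rcases hs g with h | h
        · exact continuous_id.congr fun x ↦ (h x).symm
        · exact hσ.congr fun x ↦ (h x).symm
      apply_eq_iff_mem_orbit := fun {x x'} ↦ by
        rw [eq_comm, hfibre]
        constructor
        · rintro (rfl | rfl)
          · exact MulAction.mem_orbit_self _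
          · exact ⟨⟨s, Subgroup.mem_zpowers s⟩, rfl⟩
        · rintro ⟨g, rfl⟩
          exact (hs g).imp (· x') (· x')
      disjoint := fun x ↦ by
        obtain ⟨U, hU, hUσ⟩ := hdisj x
        refine ⟨U, hU, ?_⟩
        rintro g ⟨_, ⟨u, hu, rfl⟩, hgu⟩
        rcases hs g with h | h
        · exact Subtype.ext (Equiv.ext h)
        · exact absurd (h u ▸ hgu) (Set.disjoint_left.1 hUσ ⟨u, hu, rfl⟩) }
  exact hquot.isCoveringMap

end Coverings

section LocalDiffeomorph

variable {𝕜 : Type*} [NontriviallyNormedField 𝕜] {n : ℕ∞ω}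
  {E₁ E₂ E₃ : Type*} [NormedAddCommGroup E₁] [NormedSpace 𝕜 E₁] [NormedAddCommGroup E₂]
  [NormedSpace 𝕜 E₂] [NormedAddCommGroup E₃] [NormedSpace 𝕜 E₃]
  {H₁ H₂ H₃ : Type*} [TopologicalSpace H₁] [TopologicalSpace H₂] [TopologicalSpace H₃]
  {I₁ : ModelWithCorners 𝕜 E₁ H₁} {I₂ : ModelWithCorners 𝕜 E₂ H₂} {I₃ : ModelWithCorners 𝕜 E₃ H₃}
  {M₁ M₂ M₃ : Type*} [TopologicalSpace M₁] [ChartedSpace H₁ M₁] [TopologicalSpace M₂]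
  [ChartedSpace H₂ M₂] [TopologicalSpace M₃] [ChartedSpace H₃ M₃] {π : M₁ → M₂} {f : M₂ → M₃}

theorem contMDiff_of_comp_isLocalDiffeomorph (hπ : IsLocalDiffeomorph I₁ I₂ n π)
    (hsurj : Function.Surjective π) (hf : ContMDiff I₁ I₃ n (f ∘ π)) : ContMDiff I₂ I₃ n f := by
  intro y
  obtain ⟨x, rfl⟩ := hsurj y
  have hinv := (hf _).comp _ (hπ x).localInverse_contMDiffAt
  refine hinv.congr_of_eventuallyEq ?_
  filter_upwards [(hπ x).localInverse_eventuallyEq_right] with y hy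
  exact congrArg f hy.symm

theorem isLocalDiffeomorph_of_comp_isLocalDiffeomorph (hπ : IsLocalDiffeomorph I₁ I₂ n π)
    (hsurj : Function.Surjective π) (hf : IsLocalDiffeomorph I₁ I₃ n (f ∘ π)) :
    IsLocalDiffeomorph I₂ I₃ n f := by
  intro y
  obtain ⟨x, rfl⟩ := hsurj y
  obtain ⟨Φ, hx, hΦ⟩ := hf x
  refine ⟨(hπ x).localInverse.trans Φ, ⟨(hπ x).localInverse_mem_source, ?_⟩, ?_⟩
  · change (hπ x).localInverse (π x) ∈ Φ.source
    rwa [(hπ x).localInverse_left_inv (hπ x).localInverse_mem_target]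
  · rintro y ⟨hy, hy'⟩
    refine (congrArg f ((hπ x).localInverse_right_inv hy)).symm.trans (hΦ hy')

end LocalDiffeomorph

/-! ### Constant fields of endomorphisms -/

section Charts

variable {E : Type*} [NormedAddCommGroup E] [NormedSpace ℝ E]

theorem nijenhuis_lieBracket_const (L : E →L[ℝ] E) {V W : E → E} {y : E}
    (hV : DifferentiableAt ℝ V y) (hW : DifferentiableAt ℝ W y) :
    VectorField.lieBracket ℝ (fun z ↦ L (V z)) (fun z ↦ L (W z)) y
        - L (VectorField.lieBracket ℝ (fun z ↦ L (V z)) W y)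
        - L (VectorField.lieBracket ℝ V (fun z ↦ L (W z)) y)
        + L (L (VectorField.lieBracket ℝ V W y)) = 0 := by
  have hLV : fderiv ℝ (fun z ↦ L (V z)) y = L.comp (fderiv ℝ V y) :=
    (L.hasFDerivAt.comp y hV.hasFDerivAt).fderiv
  have hLW : fderiv ℝ (fun z ↦ L (W z)) y = L.comp (fderiv ℝ W y) :=
    (L.hasFDerivAt.comp y hW.hasFDerivAt).fderiv
  simp only [VectorField.lieBracket, hLV, hLW, ContinuousLinearMap.comp_apply, map_sub]
  abel

variable {M : Type*} [TopologicalSpace M] [ChartedSpace E M]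

/-- The derivative at `q` of the chart at `q₀`, as an endomorphism of the model space: the tangent
space at `q` is identified with `E` by the chart at `q`. -/
noncomputable def chartDeriv (q₀ q : M) : E →L[ℝ] E :=
  mfderiv 𝓘(ℝ, E) 𝓘(ℝ, E) (extChartAt 𝓘(ℝ, E) q₀) q

/-- `L` commutes with the derivatives of all coordinate changes of `M`, so that the constant field
`L` is independent of the choice of charts. -/
def CommutesWithCharts (M : Type*) [TopologicalSpace M] [ChartedSpace E M]
    (L : E →L[ℝ] E) : Prop :=
  ∀ (q₀ q : M), q ∈ (chartAt E q₀).source → ∀ v : E,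
    chartDeriv (E := E) q₀ q (L v) = L (chartDeriv (E := E) q₀ q v)

/-- The vector field `V` in the coordinates given by the chart at `q`. -/
noncomputable def chartPullback (q : M) (V : ∀ x : M, TangentSpace 𝓘(ℝ, E) x) : E → E :=
  VectorField.mpullbackWithin 𝓘(ℝ, E) 𝓘(ℝ, E) (extChartAt 𝓘(ℝ, E) q).symm V
    (Set.range 𝓘(ℝ, E))

variable [IsManifold 𝓘(ℝ, E) ∞ M]

theorem chartDeriv_self (q : M) : chartDeriv (E := E) q q = ContinuousLinearMap.id ℝ E :=
  mfderiv_extChartAt_self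

theorem continuousLinearMapAt_eq_chartDeriv {q₀ q : M} (hq : q ∈ (chartAt E q₀).source) :
    (trivializationAt E (TangentSpace 𝓘(ℝ, E)) q₀).continuousLinearMapAt ℝ q =
      chartDeriv (E := E) q₀ q :=
  TangentBundle.continuousLinearMapAt_trivializationAt hq

theorem chartDeriv_symmL {q₀ q : M} (hq : q ∈ (chartAt E q₀).source) (v : E) :
    chartDeriv (E := E) q₀ q ((trivializationAt E (TangentSpace 𝓘(ℝ, E)) q₀).symmL ℝ q v) = v := by
  rw [← continuousLinearMapAt_eq_chartDeriv hq]
  exact Bundle.Trivialization.continuousLinearMapAt_symmL _ hq v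

theorem EndoField.isSmooth_const {L : E →L[ℝ] E} (hL : CommutesWithCharts M L) :
    EndoField.IsSmooth (M := M) (fun _ ↦ L) := by
  intro q₀
  rw [contMDiffAt_hom_bundle]
  refine ⟨contMDiffAt_id, (contMDiffAt_const (c := L)).congr_of_eventuallyEq ?_⟩
  filter_upwards [(chartAt E q₀).open_source.mem_nhds (mem_chart_source E q₀)] with q hq
  ext v
  change ((trivializationAt E (TangentSpace 𝓘(ℝ, E)) q₀).continuousLinearMapAt ℝ q)
    (L ((trivializationAt E (TangentSpace 𝓘(ℝ, E)) q₀).symmL ℝ q v)) = L v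
  rw [continuousLinearMapAt_eq_chartDeriv hq]
  exact (hL q₀ q hq _).trans (congrArg L (chartDeriv_symmL hq v))

theorem contMDiffAt_bilinearForm_of_chart {B : M → E →L[ℝ] E →L[ℝ] ℝ}
    {b : E → E →L[ℝ] E →L[ℝ] ℝ} {q₀ : M} (hb : ContDiffAt ℝ ∞ b (chartAt E q₀ q₀))
    (hB : ∀ q ∈ (chartAt E q₀).source, ∀ u v, B q u v =
      b (chartAt E q₀ q) (chartDeriv (E := E) q₀ q u) (chartDeriv (E := E) q₀ q v)) :
    ContMDiffAt 𝓘(ℝ, E) (𝓘(ℝ, E).prod 𝓘(ℝ, E →L[ℝ] E →L[ℝ] ℝ)) ∞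
      (fun q ↦ Bundle.TotalSpace.mk' (E →L[ℝ] E →L[ℝ] ℝ)
        (E := fun q : M ↦ TangentSpace 𝓘(ℝ, E) q →L[ℝ] TangentSpace 𝓘(ℝ, E) q →L[ℝ] ℝ)
        q (B q)) q₀ := by
  rw [contMDiffAt_hom_bundle]
  have hchart : ContMDiffAt 𝓘(ℝ, E) 𝓘(ℝ, E) ∞ (chartAt E q₀) q₀ :=
    contMDiffAt_of_mem_maximalAtlas (IsManifold.chart_mem_maximalAtlas q₀) (mem_chart_source _ q₀)
  refine ⟨contMDiffAt_id, (hb.contMDiffAt.comp q₀ hchart).congr_of_eventuallyEq ?_⟩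
  filter_upwards [(chartAt E q₀).open_source.mem_nhds (mem_chart_source E q₀)] with q hq
  refine ContinuousLinearMap.ext fun u ↦ ContinuousLinearMap.ext fun v ↦ ?_
  refine (inCoordinates_apply_eq₂ (E₃ := Bundle.Trivial M ℝ) hq hq (Set.mem_univ _)).trans ?_
  have h := hB q hq ((trivializationAt E (TangentSpace 𝓘(ℝ, E)) q₀).symmL ℝ q u)
    ((trivializationAt E (TangentSpace 𝓘(ℝ, E)) q₀).symmL ℝ q v)
  rw [chartDeriv_symmL hq, chartDeriv_symmL hq] at h
  refine Eq.trans ?_ h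
  simp only [Bundle.Trivial.fiberBundle_trivializationAt',
    Bundle.Trivial.linearMapAt_trivialization, LinearMap.id_apply]
  exact congrArg₂ (fun a b : E ↦ B q a b) (Bundle.Trivialization.symmL_apply _ hq u).symm
    (Bundle.Trivialization.symmL_apply _ hq v).symm

theorem mlieBracket_eq_lieBracket (V W : ∀ x : M, TangentSpace 𝓘(ℝ, E) x) (q : M) :
    (VectorField.mlieBracket 𝓘(ℝ, E) V W q : E) =
      VectorField.lieBracket ℝ (chartPullback q V) (chartPullback q W)
        (extChartAt 𝓘(ℝ, E) q q) := by
  have hinv : (chartDeriv (E := E) q q).inverse = ContinuousLinearMap.id ℝ E := by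
    rw [chartDeriv_self, ContinuousLinearMap.inverse_id]
  have huniv : (extChartAt 𝓘(ℝ, E) q).symm ⁻¹' (Set.univ : Set M) ∩ Set.range 𝓘(ℝ, E) =
      Set.univ := by
    rw [Set.preimage_univ, Set.univ_inter, ModelWithCorners.range_eq_univ]
  change (chartDeriv (E := E) q q).inverse
    (VectorField.lieBracketWithin ℝ (chartPullback q V) (chartPullback q W)
      ((extChartAt 𝓘(ℝ, E) q).symm ⁻¹' (Set.univ : Set M) ∩ Set.range 𝓘(ℝ, E))
      (extChartAt 𝓘(ℝ, E) q q)) = _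
  rw [hinv, huniv, VectorField.lieBracketWithin_univ]
  rfl

theorem chartPullback_apply {q : M} {y : E} (hy : y ∈ (extChartAt 𝓘(ℝ, E) q).target)
    (V : ∀ x : M, TangentSpace 𝓘(ℝ, E) x) :
    chartPullback q V y = chartDeriv (E := E) q ((extChartAt 𝓘(ℝ, E) q).symm y)
      (V ((extChartAt 𝓘(ℝ, E) q).symm y)) := by
  rw [chartPullback, VectorField.mpullbackWithin_apply, ContinuousLinearMap.inverse_eq
    (mfderivWithin_extChartAt_symm_comp_mfderiv_extChartAt hy)
    (mfderiv_extChartAt_comp_mfderivWithin_extChartAt_symm hy)]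
  rfl

theorem chartPullback_const {L : E →L[ℝ] E} (hL : CommutesWithCharts M L)
    (V : ∀ x : M, TangentSpace 𝓘(ℝ, E) x) (q : M) :
    chartPullback q (fun x ↦ L (V x)) =ᶠ[𝓝 (extChartAt 𝓘(ℝ, E) q q)]
      fun y ↦ L (chartPullback q V y) := by
  filter_upwards [extChartAt_target_mem_nhds q] with y hy
  have hq : (extChartAt 𝓘(ℝ, E) q).symm y ∈ (chartAt E q).source := by
    rw [← extChartAt_source 𝓘(ℝ, E)]
    exact (extChartAt 𝓘(ℝ, E) q).map_target hy
  rw [chartPullback_apply hy V]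
  exact (chartPullback_apply hy _).trans (hL q _ hq _)

theorem differentiableAt_chartPullback [CompleteSpace E] {V : ∀ x : M, TangentSpace 𝓘(ℝ, E) x}
    {q : M} (hV : ContMDiffAt 𝓘(ℝ, E) 𝓘(ℝ, E).tangent ∞
      (fun x ↦ (Bundle.TotalSpace.mk' E x (V x) : TangentBundle 𝓘(ℝ, E) M)) q) :
    DifferentiableAt ℝ (chartPullback q V) (extChartAt 𝓘(ℝ, E) q q) := by
  have : IsManifold 𝓘(ℝ, E) 2 M := IsManifold.of_le (n := ∞) (by norm_cast)
  have h := (hV.mdifferentiableAt (by decide)).mdifferentiableWithinAt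
    (s := Set.univ) |>.differentiableWithinAt_mpullbackWithin_vectorField
  rw [Set.preimage_univ, Set.univ_inter] at h
  exact h.differentiableAt (ModelWithCorners.range_eq_univ 𝓘(ℝ, E) ▸ Filter.univ_mem)

theorem EndoField.isIntegrable_const [CompleteSpace E] {L : E →L[ℝ] E}
    (hL : CommutesWithCharts M L) : EndoField.IsIntegrable (M := M) (fun _ ↦ L) := by
  intro q V W hV hW
  have hLV := chartPullback_const hL V q
  have hLW := chartPullback_const hL W q
  let LV (x : M) : TangentSpace 𝓘(ℝ, E) x := L (V x)
  let LW (x : M) : TangentSpace 𝓘(ℝ, E) x := L (W x)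
  let bracket (X Y : ∀ x : M, TangentSpace 𝓘(ℝ, E) x) : E := VectorField.mlieBracket 𝓘(ℝ, E) X Y q
  change bracket LV LW - L (bracket LV W) - L (bracket V LW) + L (L (bracket V W)) = 0
  have h₁ : bracket LV LW = _ :=
    (mlieBracket_eq_lieBracket LV LW q).trans (hLV.lieBracket_vectorField_eq hLW)
  have h₂ : bracket LV W = _ := (mlieBracket_eq_lieBracket LV W q).trans
    (hLV.lieBracket_vectorField_eq (Filter.EventuallyEq.refl _ (chartPullback q W)))
  have h₃ : bracket V LW = _ := (mlieBracket_eq_lieBracket V LW q).trans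
    ((Filter.EventuallyEq.refl _ (chartPullback q V)).lieBracket_vectorField_eq hLW)
  have h₄ : bracket V W = _ := mlieBracket_eq_lieBracket V W q
  rw [h₁, h₂, h₃, h₄]
  exact nijenhuis_lieBracket_const L (differentiableAt_chartPullback hV)
    (differentiableAt_chartPullback hW)

end Charts

/-! ### The subgroup of index two -/

namespace Inoue

instance : Nonempty HC := ⟨⟨(Complex.I, 0), one_pos.trans_eq Complex.I_im.symm⟩⟩

theorem aff_one_zpow (u β δ : ℝ) (m : ℤ) : aff 1 one_pos 1 u β δ ^ m =
    aff 1 one_pos 1 (m * u) (m * β) (m * δ + 1 / 2 * (m * (m - 1)) * u * β) := by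
  induction m using Int.induction_on with
  | zero =>
    rw [zpow_zero, ← aff_one]
    apply aff_congr <;> simp
  | succ k ih =>
    rw [zpow_add_one, ih, aff_mul]
    refine aff_congr (mul_one 1) (mul_one 1) ?_ ?_ ?_ <;> push_cast <;> ring
  | pred k ih =>
    rw [zpow_sub_one, ih, mul_inv_eq_iff_eq_mul, aff_mul]
    refine aff_congr (mul_one 1).symm (mul_one 1).symm ?_ ?_ ?_ <;> push_cast <;> ring

theorem im_aff (s : ℝ) (hs : 0 < s) (e : ℤˣ) (u β δ : ℝ) (x : HC) :
    (aff s hs e u β δ x).1.1.im = s * x.1.1.im := by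
  rw [aff_val, Complex.add_im, Complex.im_ofReal_mul, Complex.ofReal_im, add_zero]

namespace Data

section Group

variable {ε : ℤˣ} (D : Data ε)

theorem nf_mul_φ₀ (m n l k : ℤ) : D.nf m n l k * D.φ₀ = D.nf m n l (k + 1) := by
  rw [nf, nf, φ₀, aff_mul]
  apply aff_congr
  · rw [zpow_add_one₀ D.α_pos.ne']
  · rw [zpow_add_one]
  · rw [mul_zero, zero_add]
  · rw [zpow_add_one₀ D.α_pos.ne', mul_zero, zero_add, mul_assoc]
  · rw [mul_zero, mul_zero, zero_add, zero_add]

theorem φ₀_mem : D.φ₀ ∈ D.Γ := Subgroup.subset_closure (by simp)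

theorem φ_mem (i : Fin 2) : D.φ i ∈ D.Γ :=
  Subgroup.subset_closure (by fin_cases i <;> simp)

theorem φ₃_mem : D.φ₃ ∈ D.Γ := Subgroup.subset_closure (by simp)

theorem nf_zero_eq (m n l : ℤ) : D.nf m n l 0 = D.φ 0 ^ m * D.φ 1 ^ n * D.φ₃ ^ l := by
  rw [φ, φ, φ₃, aff_one_zpow, aff_one_zpow, aff_one_zpow, aff_mul, aff_mul, nf]
  apply aff_congr <;> simp [h] <;> ring

theorem nf_mem (m n l k : ℤ) : D.nf m n l k ∈ D.Γ := by
  have hmul (k : ℤ) : D.nf m n l (k + 1) ∈ D.Γ ↔ D.nf m n l k ∈ D.Γ := by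
    rw [← nf_mul_φ₀, Subgroup.mul_mem_cancel_right _ D.φ₀_mem]
  induction k using Int.induction_on with
  | zero =>
    rw [nf_zero_eq]
    exact mul_mem (mul_mem (zpow_mem (D.φ_mem 0) _) (zpow_mem (D.φ_mem 1) _))
      (zpow_mem D.φ₃_mem _)
  | succ k ih => exact (hmul k).2 ih
  | pred k ih => rwa [← hmul, sub_add_cancel]

theorem im_φ₀ (x : HC) : (D.φ₀ x).1.1.im = D.α * x.1.1.im := im_aff ..

theorem proj_eq_iff {x y : HC} : D.proj x = D.proj y ↔ ∃ γ ∈ D.Γ, γ y = x := by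
  rw [D.isQuotientCoveringMap_proj.apply_eq_iff_mem_orbit]
  exact ⟨fun ⟨γ, h⟩ ↦ ⟨γ, γ.2, h⟩, fun ⟨γ, hγ, h⟩ ↦ ⟨⟨γ, hγ⟩, h⟩⟩

end Group

section Double

variable (D : Data (-1))

theorem exists_h_sq (m n : ℤ) : ∃ j : ℤ, D.h m n =
    D.h (m * (D.N ^ 2) 0 0 + n * (D.N ^ 2) 1 0) (m * (D.N ^ 2) 0 1 + n * (D.N ^ 2) 1 1)
      + j * D.A := by
  obtain ⟨j, hj⟩ := D.exists_h m n
  obtain ⟨j', hj'⟩ := D.exists_h (m * D.N 0 0 + n * D.N 1 0) (m * D.N 0 1 + n * D.N 1 1)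
  have hN (i : Fin 2) : m * (D.N ^ 2) 0 i + n * (D.N ^ 2) 1 i =
      (m * D.N 0 0 + n * D.N 1 0) * D.N 0 i + (m * D.N 0 1 + n * D.N 1 1) * D.N 1 i := by
    simp only [pow_two, Matrix.mul_apply, Fin.sum_univ_two]
    ring
  refine ⟨j' - j, ?_⟩
  rw [hN, hN]
  push_cast at hj hj' ⊢
  linear_combination hj' - hj

theorem map_N_sq_mulVec {v : Fin 2 → ℝ} {t : ℝ}
    (hv : (D.N.map (Int.cast : ℤ → ℝ)).mulVec v = t • v) :
    ((D.N ^ 2).map (Int.cast : ℤ → ℝ)).mulVec v = t ^ 2 • v := by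
  have hmap : (D.N ^ 2).map (Int.cast : ℤ → ℝ) = (D.N.map (Int.cast : ℤ → ℝ)) ^ 2 :=
    map_pow (Int.castRingHom ℝ).mapMatrix D.N 2
  rw [hmap, pow_two, ← Matrix.mulVec_mulVec, hv, Matrix.mulVec_smul, hv, smul_smul, pow_two]

theorem exists_c_sq (i : Fin 2) : ∃ j : ℤ, D.c i =
    ((D.N ^ 2) i 0 * D.c 0 + (D.N ^ 2) i 1 * D.c 1)
    + (1 / 2 * ((D.N ^ 2) i 0 * ((D.N ^ 2) i 0 - 1)) * D.a 0 * D.b 0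
        + 1 / 2 * ((D.N ^ 2) i 1 * ((D.N ^ 2) i 1 - 1)) * D.a 1 * D.b 1
        + (D.N ^ 2) i 0 * (D.N ^ 2) i 1 * D.b 0 * D.a 1)
    + D.A * j := by
  have key : ∃ j : ℤ, D.c i = D.h ((D.N ^ 2) i 0) ((D.N ^ 2) i 1) + j * D.A := by
    fin_cases i
    · simpa [h] using D.exists_h_sq 1 0
    · simpa [h] using D.exists_h_sq 0 1
  obtain ⟨j, hj⟩ := key
  rw [h] at hj
  exact ⟨j, by linear_combination hj⟩

/-- The data defining the surface of type `S^+` that doubly covers the surface of type `S^-` given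
by `D`. -/
noncomputable def double : Data 1 where
  N := D.N ^ 2
  p := (D.exists_c_sq 0).choose
  q := (D.exists_c_sq 1).choose
  r := D.r
  α := D.α ^ 2
  a := D.a
  b := D.b
  c := D.c
  r_ne_zero := D.r_ne_zero
  one_lt_α := one_lt_pow₀ D.one_lt_α two_ne_zero
  det_N := by
    rw [Matrix.det_pow, D.det_N, ← Units.val_pow_eq_pow_val]
    rfl
  a_ne_zero := D.a_ne_zero
  b_ne_zero := D.b_ne_zero
  N_mulVec_a := D.map_N_sq_mulVec D.N_mulVec_a
  N_mulVec_b := by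
    rw [D.map_N_sq_mulVec D.N_mulVec_b, div_pow, pow_two, eps_sq, Units.val_one, Int.cast_one]
  c_eq i := by
    rw [Units.val_one, Int.cast_one, one_mul]
    fin_cases i
    · exact (D.exists_c_sq 0).choose_spec
    · exact (D.exists_c_sq 1).choose_spec

theorem double_nf (m n l k : ℤ) : D.double.nf m n l k = D.nf m n l (2 * k) := by
  have hα : D.double.α ^ k = D.α ^ (2 * k) := (zpow_mul D.α 2 k).symm
  rw [nf, nf]
  refine aff_congr hα ?_ rfl (congrArg _ hα) rfl
  rw [zpow_mul]
  rfl

theorem φ₀_mul_φ₀ : D.φ₀ * D.φ₀ = D.double.φ₀ := by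
  rw [φ₀, φ₀, aff_mul]
  apply aff_congr <;> simp [double, pow_two]

theorem Γ_double_le : D.double.Γ ≤ D.Γ := by
  intro γ hγ
  obtain ⟨m, n, l, k, rfl⟩ := D.double.exists_nf hγ
  rw [double_nf]
  exact D.nf_mem _ _ _ _

theorem α_zpow_injective {k k' : ℤ} {t : ℝ} (ht : t ≠ 0)
    (h : D.α ^ k * t = D.α ^ k' * t) : k = k' :=
  (zpow_right_strictMono₀ D.one_lt_α).injective (mul_right_cancel₀ ht h)

theorem mem_Γ_double_iff {γ : Equiv.Perm HC} : γ ∈ D.double.Γ ↔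
    γ ∈ D.Γ ∧ ∃ k : ℤ, ∀ x, (γ x).1.1.im = D.α ^ (2 * k) * x.1.1.im := by
  constructor
  · intro hγ
    obtain ⟨m, n, l, k, rfl⟩ := D.double.exists_nf hγ
    rw [double_nf]
    exact ⟨D.nf_mem _ _ _ _, k, im_aff _ _ _ _ _ _⟩
  · rintro ⟨hγ, k, hk⟩
    obtain ⟨m, n, l, k', rfl⟩ := D.exists_nf hγ
    let x : HC := Classical.arbitrary HC
    have hx : D.α ^ k' * x.1.1.im = D.α ^ (2 * k) * x.1.1.im := (im_aff ..).symm.trans (hk x)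
    obtain rfl := D.α_zpow_injective x.2.ne' hx
    rw [← double_nf]
    exact D.double.nf_mem _ _ _ _

theorem conj_φ₀_mem_Γ_double {γ : Equiv.Perm HC} (hγ : γ ∈ D.double.Γ) :
    D.φ₀ * γ * D.φ₀⁻¹ ∈ D.double.Γ := by
  obtain ⟨hγ, k, hk⟩ := D.mem_Γ_double_iff.1 hγ
  refine D.mem_Γ_double_iff.2 ⟨mul_mem (mul_mem D.φ₀_mem hγ) (inv_mem D.φ₀_mem), k, fun x ↦ ?_⟩
  obtain ⟨y, rfl⟩ := D.φ₀.surjective x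
  rw [Equiv.Perm.mul_apply, Equiv.Perm.mul_apply, Equiv.Perm.inv_def, Equiv.symm_apply_apply,
    im_φ₀, im_φ₀, hk, mul_left_comm]

theorem φ₀_notMem_Γ_double : D.φ₀ ∉ D.double.Γ := by
  intro hφ₀
  obtain ⟨-, k, hk⟩ := D.mem_Γ_double_iff.1 hφ₀
  let x : HC := Classical.arbitrary HC
  have hx : D.α ^ (1 : ℤ) * x.1.1.im = D.α ^ (2 * k) * x.1.1.im := by
    rw [zpow_one, ← im_φ₀, hk]
  have := D.α_zpow_injective x.2.ne' hx
  lia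

theorem mem_Γ_double_or_exists_mul_φ₀ {γ : Equiv.Perm HC} (hγ : γ ∈ D.Γ) :
    γ ∈ D.double.Γ ∨ ∃ δ ∈ D.double.Γ, δ * D.φ₀ = γ := by
  obtain ⟨m, n, l, k, rfl⟩ := D.exists_nf hγ
  have heven (j : ℤ) : D.nf m n l (2 * j) ∈ D.double.Γ :=
    D.double_nf m n l j ▸ D.double.nf_mem m n l j
  rcases Int.even_or_odd' k with ⟨j, rfl | rfl⟩
  · exact Or.inl (heven j)
  · exact Or.inr ⟨_, heven j, D.nf_mul_φ₀ m n l (2 * j)⟩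

/-- The map `S⁺ → S⁻` induced by the identity of `ℍ × ℂ`. -/
noncomputable def κ : D.double.Surface → D.Surface :=
  Quotient.lift D.proj fun _ _ h ↦ by
    obtain ⟨γ, hγ, e⟩ := D.double.proj_eq_iff.1 (Quotient.sound h)
    exact D.proj_eq_iff.2 ⟨γ, D.Γ_double_le hγ, e⟩

theorem κ_proj (x : HC) : D.κ (D.double.proj x) = D.proj x := rfl

/-- The involution of `S⁺` induced by `(z, w) ↦ (α z, -w)`. -/
noncomputable def σ : D.double.Surface → D.double.Surface :=
  Quotient.lift (fun x ↦ D.double.proj (D.φ₀ x)) fun _ y h ↦ by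
    obtain ⟨γ, hγ, rfl⟩ := D.double.proj_eq_iff.1 (Quotient.sound h)
    refine D.double.proj_eq_iff.2 ⟨_, D.conj_φ₀_mem_Γ_double hγ, ?_⟩
    rw [Equiv.Perm.mul_apply, Equiv.Perm.mul_apply, Equiv.Perm.inv_def, Equiv.symm_apply_apply]

theorem σ_proj (x : HC) : D.σ (D.double.proj x) = D.double.proj (D.φ₀ x) := rfl

theorem σ_involutive : Function.Involutive D.σ := by
  intro m
  obtain ⟨x, rfl⟩ := D.double.surjective_proj m
  rw [σ_proj, σ_proj, D.double.proj_eq_iff]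
  exact ⟨_, D.double.φ₀_mem, by rw [← φ₀_mul_φ₀, Equiv.Perm.mul_apply]⟩

theorem κ_eq_κ_iff (m m' : D.double.Surface) : D.κ m = D.κ m' ↔ m' = m ∨ m' = D.σ m := by
  obtain ⟨x, rfl⟩ := D.double.surjective_proj m
  obtain ⟨y, rfl⟩ := D.double.surjective_proj m'
  rw [κ_proj, κ_proj, σ_proj, eq_comm, D.proj_eq_iff, D.double.proj_eq_iff, D.double.proj_eq_iff]
  constructor
  · rintro ⟨γ, hγ, rfl⟩
    rcases D.mem_Γ_double_or_exists_mul_φ₀ hγ with hγ' | ⟨δ, hδ, rfl⟩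
    · exact Or.inl ⟨γ, hγ', rfl⟩
    · exact Or.inr ⟨δ, hδ, rfl⟩
  · rintro (⟨γ, hγ, rfl⟩ | ⟨γ, hγ, rfl⟩)
    · exact ⟨γ, D.Γ_double_le hγ, rfl⟩
    · exact ⟨γ * D.φ₀, mul_mem (D.Γ_double_le hγ) D.φ₀_mem, rfl⟩

theorem exists_nhds_σ_disjoint (m : D.double.Surface) :
    ∃ U ∈ 𝓝 m, Disjoint (D.σ '' U) U := by
  obtain ⟨x, rfl⟩ := D.double.surjective_proj m
  obtain ⟨V, hV, hfree⟩ := D.exists_nhds_disjoint x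
  refine ⟨D.double.proj '' V, D.double.isLocalHomeomorph_proj.isOpenMap.image_mem_nhds hV,
    Set.disjoint_left.2 ?_⟩
  rintro _ ⟨_, ⟨v, hv, rfl⟩, rfl⟩ ⟨w, hw, e⟩
  rw [σ_proj] at e
  obtain ⟨γ, hγ, rfl⟩ := D.double.proj_eq_iff.1 e
  have h1 := hfree ⟨γ * D.φ₀, mul_mem (D.Γ_double_le hγ) D.φ₀_mem⟩ ⟨_, ⟨v, hv, rfl⟩, hw⟩
  have hφ₀ : D.φ₀ = γ⁻¹ := eq_inv_of_mul_eq_one_right (congrArg Subtype.val h1)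
  exact D.φ₀_notMem_Γ_double (hφ₀ ▸ inv_mem hγ)

theorem σ_ne (m : D.double.Surface) : D.σ m ≠ m := by
  obtain ⟨U, hU, hσU⟩ := D.exists_nhds_σ_disjoint m
  have hm := mem_of_mem_nhds hU
  exact fun e ↦ Set.disjoint_left.1 hσU ⟨m, hm, e⟩ hm

theorem continuous_σ : Continuous D.σ :=
  Continuous.quotient_lift
    (D.double.isLocalHomeomorph_proj.continuous.comp (continuous_aff _ _ _ _ _ _)) _

theorem continuous_κ : Continuous D.κ :=
  Continuous.quotient_lift D.isLocalHomeomorph_proj.continuous _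

theorem isCoveringMap_κ : IsCoveringMap D.κ :=
  isCoveringMap_of_involutive
    (Topology.IsQuotientMap.of_comp (f := D.double.proj)
      D.double.isLocalHomeomorph_proj.continuous D.continuous_κ
      D.isQuotientCoveringMap_proj.toIsQuotientMap)
    D.continuous_σ D.σ_involutive D.κ_eq_κ_iff D.exists_nhds_σ_disjoint

end Double

end Data

/-! ### The projection as a local diffeomorphism -/

section AffineMaps

/-- The affine map `(z, w) ↦ (s z + u, e w + β z + δ)` of `ℂ × ℂ`, of which `aff` is the restriction
to `ℍ × ℂ`. -/
noncomputable def affMap (s : ℝ) (e : ℤˣ) (u β δ : ℝ) (x : ℂ × ℂ) : ℂ × ℂ :=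
  (s * x.1 + u, ((e : ℤ) : ℂ) * x.2 + β * x.1 + δ)

/-- The linear map `(z, w) ↦ (s z, e w + β z)` of `ℂ × ℂ`, which is the derivative of `affMap`. -/
noncomputable def lin (s : ℝ) (e : ℤˣ) (β : ℝ) : (ℂ × ℂ) →L[ℝ] (ℂ × ℂ) :=
  (s • ContinuousLinearMap.fst ℝ ℂ ℂ).prod
    (((e : ℤ) : ℝ) • ContinuousLinearMap.snd ℝ ℂ ℂ + β • ContinuousLinearMap.fst ℝ ℂ ℂ)

theorem lin_apply (s : ℝ) (e : ℤˣ) (β : ℝ) (v : ℂ × ℂ) :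
    lin s e β v = (s * v.1, ((e : ℤ) : ℂ) * v.2 + β * v.1) := by
  simp [lin]

theorem contDiff_affMap (𝕜 : Type) [NontriviallyNormedField 𝕜] [NormedAlgebra 𝕜 ℂ] (n : ℕ∞ω)
    (s : ℝ) (e : ℤˣ) (u β δ : ℝ) : ContDiff 𝕜 n (affMap s e u β δ) := by
  unfold affMap
  fun_prop

theorem hasFDerivAt_affMap (s : ℝ) (e : ℤˣ) (u β δ : ℝ) (x : ℂ × ℂ) :
    HasFDerivAt (affMap s e u β δ) (lin s e β) x := by
  have haff : affMap s e u β δ = fun x ↦ lin s e β x + ((u : ℂ), (δ : ℂ)) := by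
    ext1 x
    rw [lin_apply, affMap, Prod.mk_add_mk]
  rw [haff]
  exact (lin s e β).hasFDerivAt.add_const _

theorem hasMFDerivAt_val (x : HC) : HasMFDerivAt 𝓘(ℝ, ℂ × ℂ) 𝓘(ℝ, ℂ × ℂ)
    (Subtype.val : HC → ℂ × ℂ) x (ContinuousLinearMap.id ℝ (ℂ × ℂ)) := by
  have hid : mfderiv 𝓘(ℝ, ℂ × ℂ) 𝓘(ℝ, ℂ × ℂ) (Subtype.val : HC → ℂ × ℂ) x =
      ContinuousLinearMap.id ℝ (ℂ × ℂ) :=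
    mfderiv_extChartAt_self (I := 𝓘(ℝ, ℂ × ℂ)) (x := x)
  rw [← hid]
  exact ((contMDiff_subtype_val (n := 1)).mdifferentiableAt one_ne_zero).hasMFDerivAt

theorem hasMFDerivAt_affMap_val (s : ℝ) (e : ℤˣ) (u β δ : ℝ) (x : HC) :
    HasMFDerivAt 𝓘(ℝ, ℂ × ℂ) 𝓘(ℝ, ℂ × ℂ) (fun x : HC ↦ affMap s e u β δ x.1) x (lin s e β) :=
  (hasFDerivAt_affMap s e u β δ x.1).hasMFDerivAt.comp x (hasMFDerivAt_val x)

theorem contMDiffAt_of_val {𝕜 : Type*} [NontriviallyNormedField 𝕜] [NormedAlgebra 𝕜 ℂ] {n : ℕ∞ω}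
    {M : Type*} [TopologicalSpace M] [ChartedSpace (ℂ × ℂ) M] {f : M → HC} {x : M}
    (h : ContMDiffAt 𝓘(𝕜, ℂ × ℂ) 𝓘(𝕜, ℂ × ℂ) n (fun y ↦ (f y).1) x) :
    ContMDiffAt 𝓘(𝕜, ℂ × ℂ) 𝓘(𝕜, ℂ × ℂ) n f x :=
  contMDiffAt_iff_target.2 ⟨Topology.IsInducing.subtypeVal.continuousAt_iff.2 h.continuousAt, h⟩

theorem contMDiff_aff (𝕜 : Type) [NontriviallyNormedField 𝕜] [NormedAlgebra 𝕜 ℂ] (n : ℕ∞ω)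
    (s : ℝ) (hs : 0 < s) (e : ℤˣ) (u β δ : ℝ) :
    ContMDiff 𝓘(𝕜, ℂ × ℂ) 𝓘(𝕜, ℂ × ℂ) n (aff s hs e u β δ) := fun _ ↦
  contMDiffAt_of_val
    ((contDiff_affMap 𝕜 n s e u β δ).contMDiff.comp contMDiff_subtype_val).contMDiffAt

theorem hasMFDerivAt_aff (s : ℝ) (hs : 0 < s) (e : ℤˣ) (u β δ : ℝ) (x : HC) :
    HasMFDerivAt 𝓘(ℝ, ℂ × ℂ) 𝓘(ℝ, ℂ × ℂ) (aff s hs e u β δ) x (lin s e β) := by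
  have h := ((contMDiff_aff ℝ 1 s hs e u β δ).mdifferentiableAt one_ne_zero (x := x)).hasMFDerivAt
  have hval := (hasMFDerivAt_val (aff s hs e u β δ x)).comp x h
  have hunique := hasMFDerivAt_unique hval (hasMFDerivAt_affMap_val s e u β δ x)
  have hlin : mfderiv 𝓘(ℝ, ℂ × ℂ) 𝓘(ℝ, ℂ × ℂ) (aff s hs e u β δ) x = lin s e β := hunique
  rwa [hlin] at h

end AffineMaps

namespace Data

variable {ε : ℤˣ} (D : Data ε)

theorem exists_smul_eq_aff (γ : D.Γ) : ∃ (s : ℝ) (hs : 0 < s) (k : ℤ) (u β δ : ℝ),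
    ∀ x : HC, γ • x = aff s hs (ε ^ k) u β δ x := by
  obtain ⟨m, n, l, k, hγ⟩ := D.exists_nf γ.2
  exact ⟨_, _, k, _, _, _, fun x ↦ congrArg (· x) hγ⟩

/-- The point of `ℍ × ℂ` above `q` at which the local inverse of `proj` serves as chart at `q`. -/
noncomputable def lift (q : D.Surface) : HC := D.surjective_proj.hasRightInverse.choose q

theorem proj_lift (q : D.Surface) : D.proj (D.lift q) = q :=
  D.surjective_proj.hasRightInverse.choose_spec q

theorem chartAt_apply (q q' : D.Surface) :
    chartAt (ℂ × ℂ) q q' = (D.isLocalHomeomorph_proj.localInverseAt (D.lift q) q').1 := rfl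

theorem chartAt_source (q : D.Surface) :
    (chartAt (ℂ × ℂ) q).source = (D.isLocalHomeomorph_proj.localInverseAt (D.lift q)).source := by
  change ((D.isLocalHomeomorph_proj.localInverseAt (D.lift q)).trans
    (chartAt (ℂ × ℂ) (D.lift q))).source = _
  rw [OpenPartialHomeomorph.trans_source, TopologicalSpace.Opens.chartAt_eq,
    OpenPartialHomeomorph.subtypeRestr_source]
  exact Set.inter_eq_left.2 fun _ _ ↦ Set.mem_univ _

theorem localInverseAt_lift (q : D.Surface) :
    D.isLocalHomeomorph_proj.localInverseAt (D.lift q) q = D.lift q := by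
  nth_rw 2 [← D.proj_lift q]
  exact D.isLocalHomeomorph_proj.localInverseAt_apply_self

theorem exists_chartAt_proj {q : D.Surface} {x : HC}
    (hx : D.proj x ∈ (chartAt (ℂ × ℂ) q).source) :
    ∃ (s : ℝ) (_ : 0 < s) (k : ℤ) (u β δ : ℝ),
      ∀ᶠ y in 𝓝 x, chartAt (ℂ × ℂ) q (D.proj y) = affMap s (ε ^ k) u β δ y.1 := by
  rw [chartAt_source] at hx
  obtain ⟨γ, hγ⟩ := exists_eventually_localInverseAt_eq_smul D.isQuotientCoveringMap_proj
    D.isLocalHomeomorph_proj hx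
  obtain ⟨s, hs, k, u, β, δ, haff⟩ := D.exists_smul_eq_aff γ
  refine ⟨s, hs, k, u, β, δ, hγ.mono fun y hy ↦ ?_⟩
  rw [chartAt_apply, hy, haff]
  rfl

section Smoothness

variable (𝕜 : Type) [NontriviallyNormedField 𝕜] [NormedAlgebra 𝕜 ℂ] (n : ℕ∞ω)

theorem contMDiff_proj : ContMDiff 𝓘(𝕜, ℂ × ℂ) 𝓘(𝕜, ℂ × ℂ) n D.proj := by
  intro x
  rw [contMDiffAt_iff_target]
  refine ⟨D.isLocalHomeomorph_proj.continuous.continuousAt, ?_⟩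
  obtain ⟨s, -, k, u, β, δ, h⟩ := D.exists_chartAt_proj (mem_chart_source (ℂ × ℂ) (D.proj x))
  refine ContMDiffAt.congr_of_eventuallyEq ?_ h
  exact ((contDiff_affMap 𝕜 n _ _ _ _ _).contMDiff.comp contMDiff_subtype_val).contMDiffAt

theorem contMDiffOn_localInverseAt (x : HC) :
    ContMDiffOn 𝓘(𝕜, ℂ × ℂ) 𝓘(𝕜, ℂ × ℂ) n (D.isLocalHomeomorph_proj.localInverseAt x)
      (D.isLocalHomeomorph_proj.localInverseAt x).source := by
  have := D.isManifold 𝕜 n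
  intro q hq
  set L := D.isLocalHomeomorph_proj.localInverseAt (D.lift q)
  have hqL : q ∈ L.source := by
    rw [← chartAt_source]
    exact mem_chart_source _ q
  have hLq : Filter.Tendsto L (𝓝 q) (𝓝 (D.lift q)) := by
    simpa only [ContinuousAt, L, D.localInverseAt_lift q] using L.continuousAt hqL
  rw [← D.proj_lift q] at hq
  obtain ⟨γ, hγ⟩ := exists_eventually_localInverseAt_eq_smul D.isQuotientCoveringMap_proj
    D.isLocalHomeomorph_proj hq
  obtain ⟨s, hs, k, u, β, δ, haff⟩ := D.exists_smul_eq_aff γ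
  have hchart : ContMDiffAt 𝓘(𝕜, ℂ × ℂ) 𝓘(𝕜, ℂ × ℂ) n (chartAt (ℂ × ℂ) q) q :=
    contMDiffAt_of_mem_maximalAtlas (IsManifold.chart_mem_maximalAtlas q) (mem_chart_source _ q)
  refine ((contMDiffAt_of_val ?_ :
    ContMDiffAt 𝓘(𝕜, ℂ × ℂ) 𝓘(𝕜, ℂ × ℂ) n _ q)).contMDiffWithinAt
  refine ((contDiff_affMap 𝕜 n s (ε ^ k) u β δ).contMDiff.contMDiffAt.comp q
    hchart).congr_of_eventuallyEq ?_
  filter_upwards [hLq.eventually hγ, L.open_source.mem_nhds hqL] with q' hq' hq'L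
  rw [D.isLocalHomeomorph_proj.apply_localInverseAt_of_mem hq'L, haff] at hq'
  exact congrArg Subtype.val hq'

/-- The projection near `x`, as a diffeomorphism between open sets. -/
noncomputable def projDiffeo (x : HC) :
    PartialDiffeomorph 𝓘(𝕜, ℂ × ℂ) 𝓘(𝕜, ℂ × ℂ) HC D.Surface n where
  toPartialEquiv := ((D.isLocalHomeomorph_proj.localInverseAt x).symm.toPartialEquiv.copy
    D.proj (D.isLocalHomeomorph_proj.localInverseAt_symm x) _ rfl _ rfl _ rfl)
  open_source := (D.isLocalHomeomorph_proj.localInverseAt x).open_target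
  open_target := (D.isLocalHomeomorph_proj.localInverseAt x).open_source
  contMDiffOn_toFun := (D.contMDiff_proj 𝕜 n).contMDiffOn
  contMDiffOn_invFun := D.contMDiffOn_localInverseAt 𝕜 n x

theorem isLocalDiffeomorph_proj : IsLocalDiffeomorph 𝓘(𝕜, ℂ × ℂ) 𝓘(𝕜, ℂ × ℂ) n D.proj := fun x ↦
  ⟨D.projDiffeo 𝕜 n x, D.isLocalHomeomorph_proj.self_mem_localInverseAt_target, fun _ _ ↦ rfl⟩

theorem isLocalDiffeomorph_κ (D : Data (-1)) :
    IsLocalDiffeomorph 𝓘(𝕜, ℂ × ℂ) 𝓘(𝕜, ℂ × ℂ) n D.κ :=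
  isLocalDiffeomorph_of_comp_isLocalDiffeomorph (D.double.isLocalDiffeomorph_proj 𝕜 n)
    D.double.surjective_proj (D.isLocalDiffeomorph_proj 𝕜 n)

theorem contMDiff_σ (D : Data (-1)) : ContMDiff 𝓘(𝕜, ℂ × ℂ) 𝓘(𝕜, ℂ × ℂ) n D.σ :=
  contMDiff_of_comp_isLocalDiffeomorph (D.double.isLocalDiffeomorph_proj 𝕜 n)
    D.double.surjective_proj ((D.double.contMDiff_proj 𝕜 n).comp (contMDiff_aff 𝕜 n _ _ _ _ _ _))

end Smoothness

/-- The derivative of the projection at `x`, as an endomorphism of `ℂ × ℂ`: the tangent space of the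
surface at `D.proj x` is identified with `ℂ × ℂ` by the chart at that point. -/
noncomputable def projDeriv (x : HC) : (ℂ × ℂ) →L[ℝ] (ℂ × ℂ) :=
  mfderiv 𝓘(ℝ, ℂ × ℂ) 𝓘(ℝ, ℂ × ℂ) D.proj x

theorem hasMFDerivAt_proj (x : HC) :
    HasMFDerivAt 𝓘(ℝ, ℂ × ℂ) 𝓘(ℝ, ℂ × ℂ) D.proj x (D.projDeriv x) :=
  ((D.contMDiff_proj ℝ 1).mdifferentiableAt one_ne_zero).hasMFDerivAt

theorem surjective_projDeriv (x : HC) : Function.Surjective (D.projDeriv x) :=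
  ((D.isLocalDiffeomorph_proj ℝ 1 x).mfderivToContinuousLinearEquiv one_ne_zero).surjective

theorem injective_projDeriv (x : HC) : Function.Injective (D.projDeriv x) :=
  ((D.isLocalDiffeomorph_proj ℝ 1 x).mfderivToContinuousLinearEquiv one_ne_zero).injective

theorem exists_chartDeriv_projDeriv {q : D.Surface} {x : HC}
    (hx : D.proj x ∈ (chartAt (ℂ × ℂ) q).source) :
    ∃ (s : ℝ) (k : ℤ) (β : ℝ), 0 < s ∧
      (∀ v, chartDeriv (E := ℂ × ℂ) q (D.proj x) (D.projDeriv x v) = lin s (ε ^ k) β v) ∧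
      (chartAt (ℂ × ℂ) q (D.proj x)).1.im = s * x.1.1.im := by
  obtain ⟨s, hs, k, u, β, δ, h⟩ := D.exists_chartAt_proj hx
  refine ⟨s, k, β, hs, ?_, ?_⟩
  · have hunique := hasMFDerivAt_unique ((mdifferentiableAt_extChartAt hx).hasMFDerivAt.comp x
      (D.hasMFDerivAt_proj x)) ((hasMFDerivAt_affMap_val s _ u β δ x).congr_of_eventuallyEq h)
    exact fun v ↦ congrArg (fun T : (ℂ × ℂ) →L[ℝ] (ℂ × ℂ) ↦ T v) hunique
  · rw [h.self_of_nhds]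
    exact im_aff s hs (ε ^ k) u β δ x

theorem exists_projDeriv_eq_lin (x : HC) :
    ∃ (s : ℝ) (e : ℤˣ) (β : ℝ), D.projDeriv x = lin s e β := by
  obtain ⟨s, k, β, -, hderiv, -⟩ :=
    D.exists_chartDeriv_projDeriv (mem_chart_source (ℂ × ℂ) (D.proj x))
  rw [chartDeriv_self] at hderiv
  exact ⟨s, ε ^ k, β, ContinuousLinearMap.ext hderiv⟩

end Data

/-! ### The invariant structure and metric -/

section Model

/-- `L` commutes with the linear parts of the transformations `aff`, so that it defines a constant
field of endomorphisms on the surfaces. -/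
def CommutesWithLin (L : (ℂ × ℂ) →L[ℝ] (ℂ × ℂ)) : Prop :=
  ∀ s e β v, L (lin s e β v) = lin s e β (L v)

/-- Complex conjugation of both coordinates of `ℂ × ℂ`. -/
noncomputable def conjMap : (ℂ × ℂ) →L[ℝ] (ℂ × ℂ) :=
  (Complex.conjCLE : ℂ →L[ℝ] ℂ).prodMap (Complex.conjCLE : ℂ →L[ℝ] ℂ)

/-- The endomorphism `J₁ = i` of `ℂ × ℂ`. -/
noncomputable def modelJ₁ : (ℂ × ℂ) →L[ℝ] (ℂ × ℂ) :=
  Complex.I • ContinuousLinearMap.id ℝ (ℂ × ℂ)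

/-- The endomorphism `J₂ = i conj` of `ℂ × ℂ`. -/
noncomputable def modelJ₂ : (ℂ × ℂ) →L[ℝ] (ℂ × ℂ) := Complex.I • conjMap

/-- The endomorphism `J₃ = -conj` of `ℂ × ℂ`. -/
noncomputable def modelJ₃ : (ℂ × ℂ) →L[ℝ] (ℂ × ℂ) := -conjMap

theorem modelJ₁_apply (v : ℂ × ℂ) : modelJ₁ v = (Complex.I * v.1, Complex.I * v.2) := rfl

theorem modelJ₂_apply (v : ℂ × ℂ) : modelJ₂ v =
    (Complex.I * (starRingEnd ℂ) v.1, Complex.I * (starRingEnd ℂ) v.2) := rfl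

theorem modelJ₃_apply (v : ℂ × ℂ) : modelJ₃ v =
    (-(starRingEnd ℂ) v.1, -(starRingEnd ℂ) v.2) := rfl

theorem modelJ₁_modelJ₁ (v : ℂ × ℂ) : modelJ₁ (modelJ₁ v) = -v := by
  ext1 <;> simp [modelJ₁_apply, ← mul_assoc]

theorem modelJ₂_modelJ₂ (v : ℂ × ℂ) : modelJ₂ (modelJ₂ v) = v := by
  ext1 <;> simp [modelJ₂_apply, ← mul_assoc]

theorem modelJ₃_modelJ₃ (v : ℂ × ℂ) : modelJ₃ (modelJ₃ v) = v := by
  ext1 <;> simp [modelJ₃_apply]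

theorem modelJ₁_modelJ₂ (v : ℂ × ℂ) : modelJ₁ (modelJ₂ v) = modelJ₃ v := by
  ext1 <;> simp [modelJ₁_apply, modelJ₂_apply, modelJ₃_apply, ← mul_assoc]

theorem modelJ₂_modelJ₁ (v : ℂ × ℂ) : modelJ₂ (modelJ₁ v) = -modelJ₃ v := by
  ext1 <;> simp [modelJ₁_apply, modelJ₂_apply, modelJ₃_apply, ← mul_assoc]

theorem commutesWithLin_modelJ₁ : CommutesWithLin modelJ₁ := fun s e β v ↦ by
  simp only [modelJ₁_apply, lin_apply]
  ext1 <;> ring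

theorem commutesWithLin_modelJ₂ : CommutesWithLin modelJ₂ := fun s e β v ↦ by
  simp only [modelJ₂_apply, lin_apply, map_add, map_mul, Complex.conj_ofReal, map_intCast]
  ext1 <;> ring

theorem commutesWithLin_modelJ₃ : CommutesWithLin modelJ₃ := fun s e β v ↦ by
  simp only [modelJ₃_apply, lin_apply, map_add, map_mul, Complex.conj_ofReal, map_intCast]
  ext1 <;> ring

/-- The bilinear form `(u, v) ↦ Im (u₁ conj v₂ + v₁ conj u₂)` on `ℂ × ℂ`, which is `Im z` times the
metric `g` at a point `(z, w)` of `ℍ × ℂ`. -/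
noncomputable def modelForm : (ℂ × ℂ) →L[ℝ] (ℂ × ℂ) →L[ℝ] ℝ :=
  (ContinuousLinearMap.compL ℝ (ℂ × ℂ) ℂ ℝ Complex.imCLM).comp
    ((ContinuousLinearMap.mul ℝ ℂ).bilinearComp (ContinuousLinearMap.fst ℝ ℂ ℂ)
        ((Complex.conjCLE : ℂ →L[ℝ] ℂ).comp (ContinuousLinearMap.snd ℝ ℂ ℂ))
      + (ContinuousLinearMap.mul ℝ ℂ).bilinearComp
        ((Complex.conjCLE : ℂ →L[ℝ] ℂ).comp (ContinuousLinearMap.snd ℝ ℂ ℂ))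
        (ContinuousLinearMap.fst ℝ ℂ ℂ))

theorem modelForm_apply (u v : ℂ × ℂ) : modelForm u v =
    u.1.im * v.2.re - u.1.re * v.2.im + (v.1.im * u.2.re - v.1.re * u.2.im) := by
  have h : modelForm u v =
      (u.1 * (starRingEnd ℂ) v.2 + (starRingEnd ℂ) u.2 * v.1).im := rfl
  rw [h, Complex.add_im, Complex.mul_im, Complex.mul_im]
  simp only [Complex.conj_re, Complex.conj_im]
  ring

theorem modelForm_comm (u v : ℂ × ℂ) : modelForm u v = modelForm v u := by
  rw [modelForm_apply, modelForm_apply, add_comm]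

theorem eq_zero_of_forall_modelForm_eq_zero {u : ℂ × ℂ} (h : ∀ v, modelForm u v = 0) : u = 0 := by
  have h_re₂ := h (Complex.I, 0)
  have h_im₂ := h (1, 0)
  have h_re₁ := h (0, Complex.I)
  have h_im₁ := h (0, 1)
  simp only [modelForm_apply, Complex.zero_re, mul_zero, Complex.zero_im, sub_self, Complex.I_im,
    one_mul, Complex.I_re, zero_mul, sub_zero, zero_add, Complex.one_im, Complex.one_re, zero_sub,
    neg_eq_zero, mul_one, add_zero] at h_re₂ h_im₂ h_re₁ h_im₁
  exact Prod.ext (Complex.ext h_re₁ h_im₁) (Complex.ext h_re₂ h_im₂)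

theorem modelForm_lin (s : ℝ) (e : ℤˣ) (β : ℝ) (u v : ℂ × ℂ) :
    modelForm (lin s e β u) (lin s e β v) = s * ((e : ℤ) : ℝ) * modelForm u v := by
  have he : ((e : ℤ) : ℂ) = (((e : ℤ) : ℝ) : ℂ) := (Complex.ofReal_intCast _).symm
  simp only [modelForm_apply, lin_apply, he, Complex.add_re, Complex.add_im,
    Complex.re_ofReal_mul, Complex.im_ofReal_mul]
  ring

theorem modelForm_modelJ₁ (u v : ℂ × ℂ) :
    modelForm (modelJ₁ u) (modelJ₁ v) = modelForm u v := by
  simp only [modelForm_apply, modelJ₁_apply, Complex.I_mul_re, Complex.I_mul_im]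
  ring

theorem modelForm_modelJ₂ (u v : ℂ × ℂ) :
    modelForm (modelJ₂ u) (modelJ₂ v) = -modelForm u v := by
  simp only [modelForm_apply, modelJ₂_apply, Complex.I_mul_re, Complex.I_mul_im,
    Complex.conj_re, Complex.conj_im]
  ring

theorem modelForm_modelJ₃ (u v : ℂ × ℂ) :
    modelForm (modelJ₃ u) (modelJ₃ v) = -modelForm u v := by
  simp only [modelForm_apply, modelJ₃_apply, Complex.neg_re, Complex.neg_im,
    Complex.conj_re, Complex.conj_im]
  ring

theorem Ω_eq (x : HC) (u v : ℂ × ℂ) :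
    Ω x u v = (x.1.1.im⁻¹ : ℝ) * (u.1 * v.2 - v.1 * u.2) := by
  simp only [Ω, θ₁, θ₂, Complex.ofReal_inv]
  ring

theorem Ω₁_eq (x : HC) (u v : ℂ × ℂ) :
    Ω₁ x u v = x.1.1.im⁻¹ * modelForm (modelJ₁ u) v := by
  simp only [Ω₁, θ₁, θ₂, div_eq_mul_inv, ← Complex.ofReal_inv, ← Complex.ofReal_mul, map_sub,
    map_mul, Complex.conj_ofReal, modelForm_apply, modelJ₁_apply, Complex.sub_re, Complex.sub_im,
    Complex.mul_re, Complex.mul_im, Complex.ofReal_re, Complex.ofReal_im, Complex.conj_re,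
    Complex.conj_im, Complex.I_re, Complex.I_im]
  ring

theorem re_Ω_eq (x : HC) (u v : ℂ × ℂ) :
    (Ω x u v).re = x.1.1.im⁻¹ * modelForm (modelJ₂ u) v := by
  rw [Ω_eq, Complex.re_ofReal_mul, modelForm_apply]
  simp only [modelJ₂_apply, Complex.sub_re, Complex.mul_re, Complex.mul_im, Complex.I_re,
    Complex.I_im, Complex.conj_re, Complex.conj_im]
  ring

theorem im_Ω_eq (x : HC) (u v : ℂ × ℂ) :
    (Ω x u v).im = x.1.1.im⁻¹ * modelForm (modelJ₃ u) v := by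
  rw [Ω_eq, Complex.im_ofReal_mul, modelForm_apply, modelJ₃_apply]
  simp only [Complex.sub_im, Complex.mul_im, Complex.neg_re, Complex.neg_im, Complex.conj_re,
    Complex.conj_im]
  ring

end Model

namespace Data

section Structure

variable {ε : ℤˣ} (D : Data ε) {L : (ℂ × ℂ) →L[ℝ] (ℂ × ℂ)}

theorem projDeriv_comm (hL : CommutesWithLin L) (x : HC) (v : ℂ × ℂ) :
    L (D.projDeriv x v) = D.projDeriv x (L v) := by
  obtain ⟨s, e, β, h⟩ := D.exists_projDeriv_eq_lin x
  rw [h, hL]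

theorem commutesWithCharts (hL : CommutesWithLin L) : CommutesWithCharts D.Surface L := by
  intro q₀ q hq v
  obtain ⟨x, rfl⟩ := D.surjective_proj q
  obtain ⟨w, rfl⟩ := D.surjective_projDeriv x v
  obtain ⟨s, k, β, -, hlin, -⟩ := D.exists_chartDeriv_projDeriv hq
  rw [D.projDeriv_comm hL, hlin, hlin, hL]

/-- The para-hypercomplex structure `(i, i conj, -conj)` on the surface. -/
noncomputable def paraHypercomplex : ParaHypercomplex (E := ℂ × ℂ) D.Surface where
  J₁ := fun _ ↦ modelJ₁
  J₂ := fun _ ↦ modelJ₂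
  J₃ := fun _ ↦ modelJ₃
  smooth₁ := EndoField.isSmooth_const (D.commutesWithCharts commutesWithLin_modelJ₁)
  smooth₂ := EndoField.isSmooth_const (D.commutesWithCharts commutesWithLin_modelJ₂)
  smooth₃ := EndoField.isSmooth_const (D.commutesWithCharts commutesWithLin_modelJ₃)
  sq₁ _ := modelJ₁_modelJ₁
  sq₂ _ := modelJ₂_modelJ₂
  sq₃ _ := modelJ₃_modelJ₃
  mul₁₂ _ := modelJ₁_modelJ₂
  mul₂₁ _ := modelJ₂_modelJ₁
  integrable₁ := EndoField.isIntegrable_const (D.commutesWithCharts commutesWithLin_modelJ₁)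
  integrable₂ := EndoField.isIntegrable_const (D.commutesWithCharts commutesWithLin_modelJ₂)
  integrable₃ := EndoField.isIntegrable_const (D.commutesWithCharts commutesWithLin_modelJ₃)

/-- The pullback to `ℍ × ℂ` of a metric on the surface. -/
noncomputable def pullbackForm (g : PseudoRiemannianMetric (E := ℂ × ℂ) D.Surface) (x : HC) :
    (ℂ × ℂ) →L[ℝ] (ℂ × ℂ) →L[ℝ] ℝ :=
  (g.form (D.proj x) : (ℂ × ℂ) →L[ℝ] (ℂ × ℂ) →L[ℝ] ℝ).bilinearComp (D.projDeriv x) (D.projDeriv x)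

variable (g : PseudoRiemannianMetric (E := ℂ × ℂ) D.Surface)

theorem pullbackForm_apply_left (hL : CommutesWithLin L) (x : HC) (u v : ℂ × ℂ) :
    D.pullbackForm g x (L u) v =
      (g.form (D.proj x) : (ℂ × ℂ) →L[ℝ] (ℂ × ℂ) →L[ℝ] ℝ) (L (D.projDeriv x u))
        (D.projDeriv x v) := by
  rw [D.projDeriv_comm hL]
  rfl

theorem pullbackForm_apply_apply (hL : CommutesWithLin L) (x : HC) (u v : ℂ × ℂ) :
    D.pullbackForm g x (L u) (L v) =
      (g.form (D.proj x) : (ℂ × ℂ) →L[ℝ] (ℂ × ℂ) →L[ℝ] ℝ) (L (D.projDeriv x u))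
        (L (D.projDeriv x v)) := by
  rw [D.projDeriv_comm hL, D.projDeriv_comm hL]
  rfl

end Structure

section Metric

variable (D : Data 1)

/-- The metric `(Im z)⁻¹ Im (u₁ conj v₂ + v₁ conj u₂)`, where the tangent space at `q` is identified
with `ℂ × ℂ` by the chart at `q`, in which the coordinates of `q` are those of `D.lift q`. -/
noncomputable def metricForm (q : D.Surface) : (ℂ × ℂ) →L[ℝ] (ℂ × ℂ) →L[ℝ] ℝ :=
  (D.lift q).1.1.im⁻¹ • modelForm

theorem modelForm_chartDeriv_projDeriv {q : D.Surface} {x : HC}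
    (hx : D.proj x ∈ (chartAt (ℂ × ℂ) q).source) (u v : ℂ × ℂ) :
    (chartAt (ℂ × ℂ) q (D.proj x)).1.im⁻¹ *
        modelForm (chartDeriv (E := ℂ × ℂ) q (D.proj x) (D.projDeriv x u))
          (chartDeriv (E := ℂ × ℂ) q (D.proj x) (D.projDeriv x v)) =
      x.1.1.im⁻¹ * modelForm u v := by
  obtain ⟨s, k, β, hs, hlin, him⟩ := D.exists_chartDeriv_projDeriv hx
  rw [hlin, hlin, him, modelForm_lin, one_zpow, Units.val_one, Int.cast_one, mul_one, mul_inv]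
  field_simp

theorem metricForm_projDeriv (x : HC) (u v : ℂ × ℂ) :
    D.metricForm (D.proj x) (D.projDeriv x u) (D.projDeriv x v) = x.1.1.im⁻¹ * modelForm u v := by
  have h := D.modelForm_chartDeriv_projDeriv (mem_chart_source (ℂ × ℂ) (D.proj x)) u v
  rwa [chartDeriv_self, chartAt_apply, localInverseAt_lift] at h

theorem metricForm_eq_modelForm_chartDeriv {q₀ q : D.Surface}
    (hq : q ∈ (chartAt (ℂ × ℂ) q₀).source) (u v : ℂ × ℂ) :
    D.metricForm q u v = (chartAt (ℂ × ℂ) q₀ q).1.im⁻¹ *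
      modelForm (chartDeriv (E := ℂ × ℂ) q₀ q u) (chartDeriv (E := ℂ × ℂ) q₀ q v) := by
  obtain ⟨x, rfl⟩ := D.surjective_proj q
  obtain ⟨u, rfl⟩ := D.surjective_projDeriv x u
  obtain ⟨v, rfl⟩ := D.surjective_projDeriv x v
  rw [metricForm_projDeriv, D.modelForm_chartDeriv_projDeriv hq]

set_option maxSynthPendingDepth 3 in
theorem contMDiff_metricForm :
    ContMDiff 𝓘(ℝ, ℂ × ℂ) (𝓘(ℝ, ℂ × ℂ).prod 𝓘(ℝ, (ℂ × ℂ) →L[ℝ] (ℂ × ℂ) →L[ℝ] ℝ)) ∞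
      (fun q ↦ Bundle.TotalSpace.mk' ((ℂ × ℂ) →L[ℝ] (ℂ × ℂ) →L[ℝ] ℝ)
        (E := fun q : D.Surface ↦
          TangentSpace 𝓘(ℝ, ℂ × ℂ) q →L[ℝ] TangentSpace 𝓘(ℝ, ℂ × ℂ) q →L[ℝ] ℝ)
        q (D.metricForm q)) := by
  intro q₀
  have him : ContDiff ℝ ∞ (fun p : ℂ × ℂ ↦ p.1.im) := Complex.imCLM.contDiff.comp contDiff_fst
  have him_ne : (chartAt (ℂ × ℂ) q₀ q₀).1.im ≠ 0 := by
    rw [chartAt_apply, localInverseAt_lift]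
    exact (D.lift q₀).2.ne'
  exact contMDiffAt_bilinearForm_of_chart ((him.contDiffAt.inv him_ne).smul contDiffAt_const)
    fun q hq ↦ D.metricForm_eq_modelForm_chartDeriv hq

/-- The neutral metric on a surface of type `S^+` given by `metricForm`. -/
noncomputable def metric : PseudoRiemannianMetric (E := ℂ × ℂ) D.Surface where
  form := D.metricForm
  smooth := D.contMDiff_metricForm
  symm q u v := congrArg ((D.lift q).1.1.im⁻¹ * ·) (modelForm_comm u v)
  nondegenerate q _ h := eq_zero_of_forall_modelForm_eq_zero fun w ↦
    (mul_eq_zero.1 (h w)).resolve_left (inv_ne_zero (D.lift q).2.ne')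

theorem metric_isCompatible : D.metric.IsCompatible D.paraHypercomplex := fun q u v ↦
  ⟨congrArg ((D.lift q).1.1.im⁻¹ * ·) (modelForm_modelJ₁ u v),
    (congrArg ((D.lift q).1.1.im⁻¹ * ·) (modelForm_modelJ₂ u v)).trans (mul_neg _ _),
    (congrArg ((D.lift q).1.1.im⁻¹ * ·) (modelForm_modelJ₃ u v)).trans (mul_neg _ _)⟩

theorem pullbackForm_metric (x : HC) (u v : ℂ × ℂ) :
    D.pullbackForm D.metric x u v = x.1.1.im⁻¹ * modelForm u v :=
  D.metricForm_projDeriv x u v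

theorem metric_J₁_eq_Ω₁ (x : HC) (u v : TangentSpace 𝓘(ℝ, ℂ × ℂ) x) :
    D.metric.form (D.proj x)
        (D.paraHypercomplex.J₁ (D.proj x) (mfderiv 𝓘(ℝ, ℂ × ℂ) 𝓘(ℝ, ℂ × ℂ) D.proj x u))
        (mfderiv 𝓘(ℝ, ℂ × ℂ) 𝓘(ℝ, ℂ × ℂ) D.proj x v) = Ω₁ x u v := by
  have hpull := D.pullbackForm_apply_left D.metric commutesWithLin_modelJ₁ x u v
  exact hpull.symm.trans ((D.pullbackForm_metric x _ v).trans (Ω₁_eq x u v).symm)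

theorem metric_J₂_eq_re_Ω (x : HC) (u v : TangentSpace 𝓘(ℝ, ℂ × ℂ) x) :
    D.metric.form (D.proj x)
        (D.paraHypercomplex.J₂ (D.proj x) (mfderiv 𝓘(ℝ, ℂ × ℂ) 𝓘(ℝ, ℂ × ℂ) D.proj x u))
        (mfderiv 𝓘(ℝ, ℂ × ℂ) 𝓘(ℝ, ℂ × ℂ) D.proj x v) = (Ω x u v).re := by
  have hpull := D.pullbackForm_apply_left D.metric commutesWithLin_modelJ₂ x u v
  exact hpull.symm.trans ((D.pullbackForm_metric x _ v).trans (re_Ω_eq x u v).symm)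

theorem metric_J₃_eq_im_Ω (x : HC) (u v : TangentSpace 𝓘(ℝ, ℂ × ℂ) x) :
    D.metric.form (D.proj x)
        (D.paraHypercomplex.J₃ (D.proj x) (mfderiv 𝓘(ℝ, ℂ × ℂ) 𝓘(ℝ, ℂ × ℂ) D.proj x u))
        (mfderiv 𝓘(ℝ, ℂ × ℂ) 𝓘(ℝ, ℂ × ℂ) D.proj x v) = (Ω x u v).im := by
  have hpull := D.pullbackForm_apply_left D.metric commutesWithLin_modelJ₃ x u v
  exact hpull.symm.trans ((D.pullbackForm_metric x _ v).trans (im_Ω_eq x u v).symm)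

end Metric

section Maps

theorem projDeriv_φ₀ {ε : ℤˣ} (D : Data ε) (x : HC) (v : ℂ × ℂ) :
    D.projDeriv (D.φ₀ x) (lin D.α ε 0 v) = D.projDeriv x v := by
  have hproj : D.proj ∘ D.φ₀ = D.proj := funext fun y ↦ D.proj_eq_iff.2 ⟨_, D.φ₀_mem, rfl⟩
  have h := (D.hasMFDerivAt_proj (D.φ₀ x)).comp x (hasMFDerivAt_aff D.α D.α_pos ε 0 0 0 x)
  have h' : HasMFDerivAt 𝓘(ℝ, ℂ × ℂ) 𝓘(ℝ, ℂ × ℂ) (D.proj ∘ D.φ₀) x (D.projDeriv x) := by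
    rw [hproj]
    exact D.hasMFDerivAt_proj x
  exact congrArg (fun T : (ℂ × ℂ) →L[ℝ] (ℂ × ℂ) ↦ T v) (hasMFDerivAt_unique h h')

theorem pullbackForm_φ₀ {ε : ℤˣ} (D : Data ε) (g : PseudoRiemannianMetric (E := ℂ × ℂ) D.Surface)
    (x : HC) (u v : ℂ × ℂ) :
    D.pullbackForm g (D.φ₀ x) (lin D.α ε 0 u) (lin D.α ε 0 v) = D.pullbackForm g x u v := by
  have hproj : D.proj (D.φ₀ x) = D.proj x := D.proj_eq_iff.2 ⟨_, D.φ₀_mem, rfl⟩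
  change (g.form (D.proj (D.φ₀ x)) : (ℂ × ℂ) →L[ℝ] (ℂ × ℂ) →L[ℝ] ℝ)
    (D.projDeriv (D.φ₀ x) (lin D.α ε 0 u)) (D.projDeriv (D.φ₀ x) (lin D.α ε 0 v)) = _
  rw [projDeriv_φ₀, projDeriv_φ₀, hproj]
  rfl

variable (D : Data (-1))

theorem mfderiv_κ (x : HC) (v : ℂ × ℂ) :
    mfderiv 𝓘(ℝ, ℂ × ℂ) 𝓘(ℝ, ℂ × ℂ) D.κ (D.double.proj x) (D.double.projDeriv x v) =
      D.projDeriv x v := by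
  have hκ : MDifferentiableAt 𝓘(ℝ, ℂ × ℂ) 𝓘(ℝ, ℂ × ℂ) D.κ (D.double.proj x) :=
    (D.isLocalDiffeomorph_κ ℝ 1).contMDiff.mdifferentiableAt one_ne_zero
  have h := hκ.hasMFDerivAt.comp x (D.double.hasMFDerivAt_proj x)
  exact congrArg (fun T : (ℂ × ℂ) →L[ℝ] (ℂ × ℂ) ↦ T v)
    (hasMFDerivAt_unique h (D.hasMFDerivAt_proj x))

theorem mfderiv_σ (x : HC) (v : ℂ × ℂ) :
    mfderiv 𝓘(ℝ, ℂ × ℂ) 𝓘(ℝ, ℂ × ℂ) D.σ (D.double.proj x) (D.double.projDeriv x v) =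
      D.double.projDeriv (D.φ₀ x) (lin D.α (-1) 0 v) := by
  have hσ : MDifferentiableAt 𝓘(ℝ, ℂ × ℂ) 𝓘(ℝ, ℂ × ℂ) D.σ (D.double.proj x) :=
    (D.contMDiff_σ ℝ 1).mdifferentiableAt one_ne_zero
  have h := hσ.hasMFDerivAt.comp x (D.double.hasMFDerivAt_proj x)
  have h' := (D.double.hasMFDerivAt_proj (D.φ₀ x)).comp x
    (hasMFDerivAt_aff D.α D.α_pos (-1) 0 0 0 x)
  exact congrArg (fun T : (ℂ × ℂ) →L[ℝ] (ℂ × ℂ) ↦ T v) (hasMFDerivAt_unique h h')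

theorem related_κ {L : (ℂ × ℂ) →L[ℝ] (ℂ × ℂ)} (hL : CommutesWithLin L) :
    Related D.κ (fun _ ↦ L) (fun _ ↦ L) := by
  intro m v
  obtain ⟨x, rfl⟩ := D.double.surjective_proj m
  obtain ⟨w, rfl⟩ := D.double.surjective_projDeriv x v
  let dκ : (ℂ × ℂ) →L[ℝ] (ℂ × ℂ) :=
    mfderiv 𝓘(ℝ, ℂ × ℂ) 𝓘(ℝ, ℂ × ℂ) D.κ (D.double.proj x)
  have hdκ (w : ℂ × ℂ) : dκ (D.double.projDeriv x w) = D.projDeriv x w := D.mfderiv_κ x w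
  change L (dκ (D.double.projDeriv x w)) = dκ (L (D.double.projDeriv x w))
  rw [D.double.projDeriv_comm hL, hdκ, hdκ, D.projDeriv_comm hL]

theorem pullbackForm_metric_φ₀ (x : HC) (u v : ℂ × ℂ) :
    D.double.pullbackForm D.double.metric (D.φ₀ x) (lin D.α (-1) 0 u) (lin D.α (-1) 0 v) =
      -D.double.pullbackForm D.double.metric x u v := by
  have hα := D.α_pos.ne'
  rw [pullbackForm_metric, pullbackForm_metric, modelForm_lin, im_φ₀, mul_inv, Units.val_neg,
    Units.val_one, Int.cast_neg, Int.cast_one]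
  field_simp

theorem metric_σ (m : D.double.Surface) (u v : TangentSpace 𝓘(ℝ, ℂ × ℂ) m) :
    D.double.metric.form (D.σ m) (mfderiv 𝓘(ℝ, ℂ × ℂ) 𝓘(ℝ, ℂ × ℂ) D.σ m u)
      (mfderiv 𝓘(ℝ, ℂ × ℂ) 𝓘(ℝ, ℂ × ℂ) D.σ m v) = -D.double.metric.form m u v := by
  obtain ⟨x, rfl⟩ := D.double.surjective_proj m
  obtain ⟨u, rfl⟩ := D.double.surjective_projDeriv x u
  obtain ⟨v, rfl⟩ := D.double.surjective_projDeriv x v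
  exact (congrArg₂ (fun a b : ℂ × ℂ ↦ D.double.metricForm (D.double.proj (D.φ₀ x)) a b)
    (D.mfderiv_σ x u) (D.mfderiv_σ x v)).trans (D.pullbackForm_metric_φ₀ x u v)

end Maps

end Data

/-! ### Nonexistence of a compatible metric on `S⁻` -/

section Obstruction

instance : PreconnectedSpace HC := by
  have hconvex : Convex ℝ ((Complex.imLm ∘ₗ LinearMap.fst ℝ ℂ ℂ) ⁻¹' Set.Ioi 0) :=
    (convex_Ioi 0).linear_preimage _
  exact Subtype.preconnectedSpace hconvex.isPreconnected

theorem form_ne_zero_of_compatible {B : (ℂ × ℂ) →L[ℝ] (ℂ × ℂ) →L[ℝ] ℝ}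
    (symm : ∀ u v, B u v = B v u) (nondeg : ∀ u, (∀ v, B u v = 0) → u = 0)
    (h₁ : ∀ u v, B (modelJ₁ u) (modelJ₁ v) = B u v)
    (h₃ : ∀ u v, B (modelJ₃ u) (modelJ₃ v) = -B u v) :
    B (1, 0) (0, Complex.I) ≠ 0 := by
  intro h_z_iw
  have hJ₃ (u v : ℂ × ℂ) (hu : modelJ₃ u = -u) (hv : modelJ₃ v = -v) : B u v = 0 := by
    have h := h₃ u v
    rw [hu, hv, map_neg, map_neg, neg_apply] at h
    linarith
  have hz : modelJ₃ (1, 0) = -(1, 0) := by simp [modelJ₃_apply]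
  have hw : modelJ₃ (0, 1) = -(0, 1) := by simp [modelJ₃_apply]
  have h_z_iz : B (1, 0) (Complex.I, 0) = 0 := by
    have h := h₁ (1, 0) (modelJ₁ (1, 0))
    have hJ₁z : modelJ₁ (1, 0) = (Complex.I, 0) := by simp [modelJ₁_apply]
    rw [modelJ₁_modelJ₁, map_neg, symm, hJ₁z] at h
    linarith
  have hdegenerate : ((1, 0) : ℂ × ℂ) = 0 := by
    refine nondeg _ fun v ↦ ?_
    have hv : v = v.1.re • ((1, 0) : ℂ × ℂ) + v.1.im • ((Complex.I, 0) : ℂ × ℂ)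
        + v.2.re • ((0, 1) : ℂ × ℂ) + v.2.im • ((0, Complex.I) : ℂ × ℂ) := by
      ext <;> simp
    rw [hv]
    simp only [map_add, map_smul, hJ₃ _ _ hz hz, hJ₃ _ _ hz hw, h_z_iz, h_z_iw, smul_zero, add_zero]
  exact one_ne_zero (congrArg Prod.fst hdegenerate)

theorem continuous_const_section (u : ℂ × ℂ) : Continuous fun x : HC ↦
    (Bundle.TotalSpace.mk' (ℂ × ℂ) x u : TangentBundle 𝓘(ℝ, ℂ × ℂ) HC) := by
  rw [continuous_iff_continuousAt]
  intro x₀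
  rw [FiberBundle.continuousAt_totalSpace]
  refine ⟨continuousAt_id, (continuousAt_const (y := u)).congr (.of_forall fun x ↦ ?_)⟩
  have hx : x ∈ (chartAt (ℂ × ℂ) x₀).source := by
    rw [TopologicalSpace.Opens.chartAt_eq, OpenPartialHomeomorph.subtypeRestr_source]
    exact Set.mem_univ _
  have hid : (trivializationAt (ℂ × ℂ) (TangentSpace 𝓘(ℝ, ℂ × ℂ)) x₀).continuousLinearMapAt ℝ x =
      ContinuousLinearMap.id ℝ (ℂ × ℂ) :=
    (TangentBundle.continuousLinearMapAt_trivializationAt hx).trans (hasMFDerivAt_val x).mfderiv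
  exact (congrArg (fun T : (ℂ × ℂ) →L[ℝ] (ℂ × ℂ) ↦ T u) hid).symm.trans
    (Bundle.Trivialization.continuousLinearMapAt_apply_of_mem (R := ℝ)
      (trivializationAt (ℂ × ℂ) (TangentSpace 𝓘(ℝ, ℂ × ℂ)) x₀) hx u)

end Obstruction

namespace Data

section Pullback

variable {ε : ℤˣ} (D : Data ε) (g : PseudoRiemannianMetric (E := ℂ × ℂ) D.Surface)

theorem continuous_pullbackForm (u v : ℂ × ℂ) : Continuous fun x ↦ D.pullbackForm g x u v := by
  have hsection (u : ℂ × ℂ) : Continuous fun x : HC ↦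
      Bundle.TotalSpace.mk' (ℂ × ℂ) (E := TangentSpace 𝓘(ℝ, ℂ × ℂ)) (D.proj x)
        (D.projDeriv x u) :=
    ((D.contMDiff_proj ℝ 1).continuous_tangentMap le_rfl).comp (continuous_const_section u)
  have hform := g.smooth.continuous.comp D.isLocalHomeomorph_proj.continuous
  have hpair := Continuous.clm_bundle_apply₂ (E₃ := Bundle.Trivial D.Surface ℝ) hform
    (hsection u) (hsection v)
  exact continuous_snd.comp ((Bundle.Trivial.homeomorphProd D.Surface ℝ).continuous.comp hpair)

theorem pullbackForm_nondegenerate (x : HC) (u : ℂ × ℂ) (hu : ∀ v, D.pullbackForm g x u v = 0) :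
    u = 0 := by
  refine D.injective_projDeriv x ((g.nondegenerate (D.proj x) _ fun w ↦ ?_).trans
    (map_zero (D.projDeriv x)).symm)
  obtain ⟨v, rfl⟩ := D.surjective_projDeriv x w
  exact hu v

variable {g}

theorem pullbackForm_ne_zero (hg : g.IsCompatible D.paraHypercomplex) (x : HC) :
    D.pullbackForm g x (1, 0) (0, Complex.I) ≠ 0 :=
  form_ne_zero_of_compatible (fun _ _ ↦ g.symm _ _ _) (D.pullbackForm_nondegenerate g x)
    (fun u v ↦ (D.pullbackForm_apply_apply g commutesWithLin_modelJ₁ x u v).trans (hg _ _ _).1)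
    fun u v ↦ (D.pullbackForm_apply_apply g commutesWithLin_modelJ₃ x u v).trans (hg _ _ _).2.2

end Pullback

variable (D : Data (-1))

theorem pullbackForm_eq_neg_α_mul (g : PseudoRiemannianMetric (E := ℂ × ℂ) D.Surface) (x : HC) :
    D.pullbackForm g x (1, 0) (0, Complex.I) =
      -(D.α * D.pullbackForm g (D.φ₀ x) (1, 0) (0, Complex.I)) := by
  have hz : lin D.α (-1) 0 (1, 0) = D.α • ((1, 0) : ℂ × ℂ) := by simp [lin_apply]
  have hw : lin D.α (-1) 0 (0, Complex.I) = -(0, Complex.I) := by simp [lin_apply]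
  rw [← D.pullbackForm_φ₀, hz, hw, map_neg, map_smul, smul_apply, smul_eq_mul]

theorem not_exists_compatible : ¬ ∃ h : PseudoRiemannianMetric (E := ℂ × ℂ) D.Surface,
    h.IsCompatible D.paraHypercomplex := by
  rintro ⟨h, hcompatible⟩
  let F : HC → ℝ := fun x ↦ D.pullbackForm h x (1, 0) (0, Complex.I)
  have hF : Continuous F := D.continuous_pullbackForm h _ _
  let x : HC := Classical.arbitrary HC
  have hsign : F x = -(D.α * F (D.φ₀ x)) := D.pullbackForm_eq_neg_α_mul h x
  have hα := D.α_pos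
  have hzero : (0 : ℝ) ∈ Set.range F := by
    rcases le_total (F x) 0 with hx | hx
    · exact mem_range_of_exists_le_of_exists_ge hF ⟨x, hx⟩ ⟨D.φ₀ x, by nlinarith⟩
    · exact mem_range_of_exists_le_of_exists_ge hF ⟨D.φ₀ x, by nlinarith⟩ ⟨x, hx⟩
  obtain ⟨y, hy⟩ := hzero
  exact D.pullbackForm_ne_zero hcompatible y hy

end Data

end Inoue

theorem mainTheorem1 (D : Inoue.Data (-1)) :
    ∃ (D' : Inoue.Data 1) (κ : D'.Surface → D.Surface) (σ : D'.Surface → D'.Surface)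
      (g : PseudoRiemannianMetric (E := ℂ × ℂ) D'.Surface)
      (P : ParaHypercomplex (E := ℂ × ℂ) D'.Surface)
      (Q : ParaHypercomplex (E := ℂ × ℂ) D.Surface),
      -- the surface `S^+` (with `t = 0`) belonging to `N²`
      (D'.N = D.N ^ 2 ∧ D'.α = D.α ^ 2 ∧ D'.a = D.a ∧ D'.b = D.b ∧ D'.c = D.c ∧ D'.r = D.r) ∧
      -- is a double covering of `S^-`, induced by the identity of `ℍ × ℂ`,
      (∀ x, κ (D'.proj x) = D.proj x) ∧
      IsLocalDiffeomorph 𝓘(ℂ, ℂ × ℂ) 𝓘(ℂ, ℂ × ℂ) ω κ ∧ IsCoveringMap κ ∧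
      -- and `S^-` is its quotient by the fixed point free holomorphic involution `σ` that is
      -- induced by `(z, w) ↦ (α z, -w)`
      (∀ x, σ (D'.proj x) = D'.proj (D.φ₀ x)) ∧
      ContMDiff 𝓘(ℂ, ℂ × ℂ) 𝓘(ℂ, ℂ × ℂ) ω σ ∧
      (∀ m, σ (σ m) = m) ∧ (∀ m, σ m ≠ m) ∧ (∀ m m', κ m = κ m' ↔ m' = m ∨ m' = σ m) ∧
      -- `(g, P)` is the para-hyperhermitian structure on `S^+` defined by `(Ω₁, Re Ω, Im Ω)`
      g.IsCompatible P ∧ P.J₁ = Inoue.complexStructure D'.Surface ∧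
      (∀ (x : Inoue.HC) (u v : TangentSpace 𝓘(ℝ, ℂ × ℂ) x),
        g.form (D'.proj x)
            (P.J₁ (D'.proj x) (mfderiv 𝓘(ℝ, ℂ × ℂ) 𝓘(ℝ, ℂ × ℂ) D'.proj x u))
            (mfderiv 𝓘(ℝ, ℂ × ℂ) 𝓘(ℝ, ℂ × ℂ) D'.proj x v) = Inoue.Ω₁ x u v ∧
        g.form (D'.proj x)
            (P.J₂ (D'.proj x) (mfderiv 𝓘(ℝ, ℂ × ℂ) 𝓘(ℝ, ℂ × ℂ) D'.proj x u))
            (mfderiv 𝓘(ℝ, ℂ × ℂ) 𝓘(ℝ, ℂ × ℂ) D'.proj x v) = (Inoue.Ω x u v).re ∧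
        g.form (D'.proj x)
            (P.J₃ (D'.proj x) (mfderiv 𝓘(ℝ, ℂ × ℂ) 𝓘(ℝ, ℂ × ℂ) D'.proj x u))
            (mfderiv 𝓘(ℝ, ℂ × ℂ) 𝓘(ℝ, ℂ × ℂ) D'.proj x v) = (Inoue.Ω x u v).im) ∧
      -- `σ` is an anti-isometry of `g`
      (∀ (m : D'.Surface) (u v : TangentSpace 𝓘(ℝ, ℂ × ℂ) m),
        g.form (σ m) (mfderiv 𝓘(ℝ, ℂ × ℂ) 𝓘(ℝ, ℂ × ℂ) σ m u)
          (mfderiv 𝓘(ℝ, ℂ × ℂ) 𝓘(ℝ, ℂ × ℂ) σ m v) = -g.form m u v) ∧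
      -- the para-hypercomplex structure `P` descends to the structure `Q` on the complex
      -- surface `S^-`
      Inoue.Related κ P.J₁ Q.J₁ ∧ Inoue.Related κ P.J₂ Q.J₂ ∧ Inoue.Related κ P.J₃ Q.J₃ ∧
      Q.J₁ = Inoue.complexStructure D.Surface ∧
      -- which admits no compatible metric
      ¬ ∃ h : PseudoRiemannianMetric (E := ℂ × ℂ) D.Surface, h.IsCompatible Q :=
  ⟨D.double, D.κ, D.σ, D.double.metric, D.double.paraHypercomplex, D.paraHypercomplex,
    ⟨rfl, rfl, rfl, rfl, rfl, rfl⟩,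
    D.κ_proj, D.isLocalDiffeomorph_κ ℂ ω, D.isCoveringMap_κ,
    D.σ_proj, D.contMDiff_σ ℂ ω, D.σ_involutive, D.σ_ne, D.κ_eq_κ_iff,
    D.double.metric_isCompatible, rfl,
    fun x u v ↦ ⟨D.double.metric_J₁_eq_Ω₁ x u v, D.double.metric_J₂_eq_re_Ω x u v,
      D.double.metric_J₃_eq_im_Ω x u v⟩,
    D.metric_σ,
    D.related_κ Inoue.commutesWithLin_modelJ₁, D.related_κ Inoue.commutesWithLin_modelJ₂,
    D.related_κ Inoue.commutesWithLin_modelJ₃, rfl, D.not_exists_compatible⟩
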